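/- **Conventions.** All groups are countable. An orbit equivalence coupling from a group $A$ to a group $B$ is a standard probability space $(X,\mu)$ with essentially free probability measure preserving actions of $A$ and $B$ such that $A\cdot x=B\cdot x$ for almost every $x$. Its cocycles $c_{A,B}\colon A\times X\to B$ and $c_{B,A}\colon B\times X\to A$ are defined almost everywhere by $a\cdot x=c_{A,B}(a,x)\cdot x$ and $b\cdot x=c_{B,A}(b,x)\cdot x$. The coupling is $\mathrm L^\infty$ if for every $a\in A$ and $b\in B$ the maps $c_{A,B}(a,\cdot)$ and $c_{B,A}(b,\cdot)$ essentially take finitely many values. If $A,B$ are finitely generated, with finite generating sets $S_A,S_B$, and $\varphi,\psi\colon\mathbb R_+\to\mathbb R_+$ are non-decreasing, the coupling is $(\varphi,\psi)$-integrable if for all $a\in A$, $b\in B$ there are $C_a,C'_b>0$ with $$\int_X\varphi\!\left(\frac{|c_{A,B}(a,x)|_{S_B}}{C_a}\right)d\mu(x)<\infty,\qquad \int_X\psi\!\left(\frac{|c_{B,A}(b,x)|_{S_A}}{C'_b}\right)d\mu(x)<\infty$$ (this does not depend on $S_A,S_B$). For normal subgroups $M\lhd H$ and $N\lhd K$, an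 orbit equivalence coupling from $(H,M)$ to $(K,N)$ is an orbit equivalence coupling $(X,\mu)$ from $H$ to $K$ such that $(X,\mu)$ is atomless and $M\cdot x=N\cdot x$ for almost every $x$; it is $(\varphi,\psi)$-integrable, or $\mathrm L^\infty$, if it is so as a coupling from $H$ to $K$. For $M\lhd H$, let $H$ act on $H/M$ by left translation. Put $\Gamma\wr_{H/M}H=\big(\bigoplus_{H/M}\Gamma\big)\rtimes H$; $\mathsf{Shuffler}(H,M)=\mathrm{FSym}(H/M)\rtimes H$; for $r\ge1$, $\mathsf{Juggler}_r(H,M)=\mathrm{FSym}\big((H/M)\times\{1,\dots,r\}\big)\rtimes H$; and, for a field $\mathbb f$, $\mathsf{Cloner}_{\mathbb f}(H,M)=\mathrm{FGL}_{\mathbb f}(H/M)\rtimes H$. Here $\mathrm{FSym}$ denotes the group of finitely supported permutations, $\mathrm{FGL}_{\mathbb f}(Y)$ the group of linear automorphisms of the $\mathbb f$-vector space with basis $Y$ that fix all but finitely many elements of $Y$, and $H$ acts by permuting coordinates, respectively by conjugation. **Theorem.** Let $\Gamma,\Lambda,H,K$ be countable groups, $M\lhd H$ and $N\lhd K$ normal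 subgroups, $\mathbb f$ a finite field. (1) Let $\varphi,\psi\colon\mathbb R_+\to\mathbb R_+$ be non-decreasing, let $H,K$ be finitely generated, and assume that there is a $(\varphi,\psi)$-integrable orbit equivalence coupling from $(H,M)$ to $(K,N)$. Then - if $\Gamma,\Lambda$ are finitely generated and there is a $(\varphi,\psi)$-integrable orbit equivalence coupling from $\Gamma$ to $\Lambda$, there is one from $\Gamma\wr_{H/M}H$ to $\Lambda\wr_{K/N}K$; - there is a $(\varphi,\psi)$-integrable orbit equivalence coupling from $\mathsf{Shuffler}(H,M)$ to $\mathsf{Shuffler}(K,N)$, and, for every integer $r\ge1$, one from $\mathsf{Juggler}_r(H,M)$ to $\mathsf{Juggler}_r(K,N)$; - there is a $(\varphi,\psi)$-integrable orbit equivalence coupling from $\mathsf{Cloner}_{\mathbb f}(H,M)$ to $\mathsf{Cloner}_{\mathbb f}(K,N)$. (2) The same implications hold, without any finite generation assumption, when "$(\varphi,\psi)$-integrable" is deleted throughout. (3) The same implications hold, without any finite generation assumption, when "$(\varphi,\psi)$-integrable" is replaced by "$\mathrm L^\infty$" throughout. -/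

import Mathlib

open MeasureTheory
open scoped NNReal ENNReal

noncomputable section

/-! ### Orbit equivalence couplings -/

/-- The (everywhere defined) action of the group `G` on `(X, μ)` is by measure-preserving Borel
transformations and is essentially free: almost every point has trivial stabilizer. -/
structure IsFreePMPAction (G : Type*) {X : Type*} [Group G] [MulAction G X] [MeasurableSpace X]
    (μ : Measure X) : Prop where
  measurePreserving : ∀ g : G, MeasurePreserving (fun x : X => g • x) μ μ
  essentiallyFree : ∀ᵐ x ∂μ, ∀ g : G, g • x = x → g = 1

/-- An orbit equivalence coupling between `H` and `K`: a standard probability space `(X, μ)` with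
essentially free probability measure preserving actions of `H` and `K` having the same orbits up to
a null set. (Every standard Borel space is isomorphic to one living in `Type`.) -/
structure OECoupling (H : Type*) (K : Type*) [Group H] [Group K] where
  /-- the underlying space -/
  X : Type
  [measurableSpace : MeasurableSpace X]
  [standardBorel : StandardBorelSpace X]
  /-- the probability measure -/
  μ : Measure X
  [isProbability : IsProbabilityMeasure μ]
  [actionLeft : MulAction H X]
  [actionRight : MulAction K X]
  freeLeft : IsFreePMPAction H μ
  freeRight : IsFreePMPAction K μ
  orbit_eq : ∀ᵐ x ∂μ, MulAction.orbit H x = MulAction.orbit K x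

attribute [instance] OECoupling.measurableSpace OECoupling.standardBorel
  OECoupling.isProbability OECoupling.actionLeft OECoupling.actionRight

/-- The word length `|g|_S`: the least length of a word in the letters `S ∪ S⁻¹` representing `g`
(only used for generating sets `S`). -/
def wordLength {G : Type*} [Group G] (S : Set G) (g : G) : ℕ :=
  sInf {n | ∃ w : List G, w.length = n ∧ (∀ s ∈ w, s ∈ S ∨ s⁻¹ ∈ S) ∧ w.prod = g}

open Classical in
/-- For groups `A`, `B` acting on `X`: the element `b` with `a • x = b • x`. When the two actions
have the same orbits and are free at `x` (almost everywhere, for a coupling) there is exactly one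
such `b`; elsewhere the value is irrelevant. -/
def cocycle (A : Type*) (B : Type*) {X : Type*} [Group A] [Group B] [MulAction A X] [MulAction B X]
    (a : A) (x : X) : B :=
  if h : ∃ b : B, a • x = b • x then h.choose else 1

/-- A map `c : A × X → B` to a finitely generated group is `φ`-integrable: for each `a` there is
`C > 0` with `∫ φ(|c(a, x)|_S / C) dμ(x) < ∞`, where `S` is a finite generating set of `B`. The
notion does not depend on `S`, as any two word lengths are bi-Lipschitz equivalent. -/
def IsPhiIntegrable {A B X : Type*} [Group B] [MeasurableSpace X] (μ : Measure X)
    (φ : ℝ≥0 → ℝ≥0) (c : A → X → B) : Prop :=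
  ∃ S : Set B, S.Finite ∧ Subgroup.closure S = ⊤ ∧
    ∀ a : A, ∃ C : ℝ≥0, 0 < C ∧
      ∫⁻ x, ((φ ((wordLength S (c a x) : ℝ≥0) / C) : ℝ≥0) : ℝ≥0∞) ∂μ < ∞

/-- A map `c : A × X → B` is `L^∞`: each `c(a, ·)` essentially takes finitely many values. -/
def IsLInfty {A B X : Type*} [MeasurableSpace X] (μ : Measure X) (c : A → X → B) : Prop :=
  ∀ a : A, ∃ F : Set B, F.Finite ∧ ∀ᵐ x ∂μ, c a x ∈ F

namespace OECoupling

variable {H K : Type*} [Group H] [Group K]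

/-- The cocycle `c_{H,K} : H × X → K`, with `h • x = c_{H,K}(h, x) • x`. -/
def cocycleLeft (c : OECoupling H K) : H → c.X → K := cocycle H K

/-- The cocycle `c_{K,H} : K × X → H`, with `k • x = c_{K,H}(k, x) • x`. -/
def cocycleRight (c : OECoupling H K) : K → c.X → H := cocycle K H

/-- The coupling is `(φ, ψ)`-integrable from `H` to `K`. -/
def IsIntegrable (c : OECoupling H K) (φ ψ : ℝ≥0 → ℝ≥0) : Prop :=
  IsPhiIntegrable c.μ φ c.cocycleLeft ∧ IsPhiIntegrable c.μ ψ c.cocycleRight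

/-- The coupling is an `L^∞` orbit equivalence coupling. -/
def IsLInftyCoupling (c : OECoupling H K) : Prop :=
  IsLInfty c.μ c.cocycleLeft ∧ IsLInfty c.μ c.cocycleRight

/-- The coupling is a coupling between the pairs `(H, M)` and `(K, N)`: the space is atomless
(points are null, which is the same on a standard Borel space) and
almost surely the `M`-orbit and the `N`-orbit of a point coincide. -/
structure IsPairCoupling (c : OECoupling H K) (M : Subgroup H) (N : Subgroup K) : Prop where
  atomless : ∀ x : c.X, c.μ {x} = 0
  orbit_eq : ∀ᵐ x ∂c.μ, MulAction.orbit M x = MulAction.orbit N x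

end OECoupling

/-! ### Permutational halo products -/

/-- Restriction of an action by automorphisms to an invariant subgroup. -/
def restrictMulAut {H A : Type*} [Group H] [Group A] (ρ : H →* MulAut A) (L : Subgroup A)
    (hL : ∀ h : H, ∀ a ∈ L, ρ h a ∈ L) : H →* MulAut L where
  toFun h :=
    { toFun := fun a => ⟨ρ h a, hL h a a.2⟩
      invFun := fun a => ⟨ρ h⁻¹ a, hL h⁻¹ a a.2⟩
      left_inv := fun a => by ext; simp
      right_inv := fun a => by ext; simp
      map_mul' := fun a b => by ext; simp }
  map_one' := by ext; simp
  map_mul' h h' := by ext; simp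

/-- The direct sum `⨁_X Γ`: finitely supported functions `X → Γ`, with pointwise product. -/
def directSumGroup (Γ X : Type*) [Group Γ] : Subgroup (X → Γ) where
  carrier := {f | {x | f x ≠ 1}.Finite}
  one_mem' := by simp
  mul_mem' {f g} hf hg := (Set.Finite.union hf hg).subset fun x hx => by
    by_contra h
    simp only [Set.mem_union, Set.mem_ofPred_eq, not_or, not_not] at h
    exact hx (by simp [h.1, h.2])
  inv_mem' {f} hf := by simpa using hf

/-- The group of finitely supported permutations of `X`. -/
def finSym (X : Type*) : Subgroup (Equiv.Perm X) where
  carrier := {σ | {x | σ x ≠ x}.Finite}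
  one_mem' := by simp
  mul_mem' {f g} hf hg := (Set.Finite.union hf hg).subset fun x hx => by
    by_contra h
    simp only [Set.mem_union, Set.mem_ofPred_eq, not_or, not_not] at h
    exact hx (by simp [h.1, h.2])
  inv_mem' {f} hf := by
    refine Set.Finite.subset hf fun x hx hfx => hx ?_
    exact Equiv.Perm.inv_eq_iff_eq.2 hfx.symm

/-- `FGL(X)` over the field `𝕜`: linear automorphisms of the vector space with basis `X` that fix
all but finitely many basis vectors. -/
def finGL (𝕜 X : Type*) [Field 𝕜] : Subgroup ((X →₀ 𝕜) ≃ₗ[𝕜] (X →₀ 𝕜)) where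
  carrier := {g | {x | g (Finsupp.single x 1) ≠ Finsupp.single x 1}.Finite}
  one_mem' := by simp
  mul_mem' {f g} hf hg := (Set.Finite.union hf hg).subset fun x hx => by
    by_contra h
    simp only [Set.mem_union, Set.mem_ofPred_eq, not_or, not_not] at h
    exact hx (by rw [LinearEquiv.mul_apply, h.2, h.1])
  inv_mem' {f} hf := by
    refine Set.Finite.subset hf fun x hx hfx => hx ?_
    exact (LinearEquiv.symm_apply_eq f).2 hfx.symm

/-- The linear action on the vector space with basis `X` induced by an action on `X`:
`h • e_x = e_{h • x}`. -/
def permLinear (𝕜 H X : Type*) [Field 𝕜] [Group H] [MulAction H X] :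
    H →* ((X →₀ 𝕜) ≃ₗ[𝕜] (X →₀ 𝕜)) where
  toFun h := Finsupp.domLCongr (MulAction.toPerm h)
  map_one' := by ext; simp
  map_mul' h h' := by
    apply LinearEquiv.toLinearMap_injective
    ext x : 2
    simp [mul_smul]

/-- Permutation of coordinates: `(h • f)(x) = f (h⁻¹ • x)`, on `⨁_X Γ`. -/
def wreathAction (Γ H X : Type*) [Group Γ] [Group H] [MulAction H X] :
    H →* MulAut (directSumGroup Γ X) :=
  restrictMulAut (mulAutArrow : H →* MulAut (X → Γ)) (directSumGroup Γ X) (by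
    intro h f hf
    refine (Set.Finite.image (fun x : X => h • x) hf).subset fun x hx => ?_
    exact ⟨h⁻¹ • x, hx, by simp⟩)

/-- For a permutation action `ρ` of `H` on `X`, the action of `H` on the finitely supported
permutations given by `(h • σ)(x) = h • σ (h⁻¹ • x)`. -/
def shuffleAction {H X : Type*} [Group H] (ρ : H →* Equiv.Perm X) : H →* MulAut (finSym X) :=
  restrictMulAut (MulAut.conj.comp ρ) (finSym X) (by
    intro h σ hσ
    refine (Set.Finite.image (fun x : X => ρ h x) hσ).subset fun x hx => ?_
    refine ⟨(ρ h)⁻¹ x, fun hx' => hx ?_, by simp⟩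
    simp only [MonoidHom.comp_apply, MulAut.conj_apply, Equiv.Perm.mul_apply]
    rw [hx', ← Equiv.Perm.mul_apply, mul_inv_cancel, Equiv.Perm.one_apply])

/-- The action of `H` on `FGL(X)` by conjugation by the linear maps `e_x ↦ e_{h • x}`. -/
def clonerAction (𝕜 H X : Type*) [Field 𝕜] [Group H] [MulAction H X] :
    H →* MulAut (finGL 𝕜 X) :=
  restrictMulAut (MulAut.conj.comp (permLinear 𝕜 H X)) (finGL 𝕜 X) (by
    intro h g hg
    refine (Set.Finite.image (fun x : X => h • x) hg).subset fun x hx => ?_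
    refine ⟨h⁻¹ • x, fun hx' => hx ?_, by simp⟩
    have e : (permLinear 𝕜 H X h)⁻¹ (Finsupp.single x (1 : 𝕜)) = Finsupp.single (h⁻¹ • x) 1 := by
      rw [← map_inv]
      simp [permLinear]
    simp only [MonoidHom.comp_apply, MulAut.conj_apply, LinearEquiv.mul_apply]
    rw [e, hx']
    simp [permLinear])

/-- The permutation action of `H` on `(H ⧸ M) × {1, …, r}`, given by `h • (x, i) = (h • x, i)`. -/
def jugglerPerm {H : Type*} [Group H] (M : Subgroup H) (r : ℕ) :
    H →* Equiv.Perm ((H ⧸ M) × Fin r) where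
  toFun h := Equiv.prodCongr (MulAction.toPerm h) (Equiv.refl (Fin r))
  map_one' := by ext x <;> simp
  map_mul' h h' := by ext x <;> simp [mul_smul]

/-- The permutational (restricted) wreath product `Γ ≀_{H/M} H = (⨁_{H/M} Γ) ⋊ H`. -/
abbrev PermWreath (Γ : Type*) {H : Type*} [Group Γ] [Group H] (M : Subgroup H) : Type _ :=
  directSumGroup Γ (H ⧸ M) ⋊[wreathAction Γ H (H ⧸ M)] H

/-- The permutational lampshuffler `FSym(H/M) ⋊ H`. -/
abbrev Lampshuffler {H : Type*} [Group H] (M : Subgroup H) : Type _ :=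
  finSym (H ⧸ M) ⋊[shuffleAction (MulAction.toPermHom H (H ⧸ M))] H

/-- The permutational lampjuggler `FSym((H/M) × {1, …, r}) ⋊ H`. -/
abbrev Lampjuggler (r : ℕ) {H : Type*} [Group H] (M : Subgroup H) : Type _ :=
  finSym ((H ⧸ M) × Fin r) ⋊[shuffleAction (jugglerPerm M r)] H

/-- The permutational lampcloner `FGL(H/M) ⋊ H` over the field `𝕜`. -/
abbrev Lampcloner (𝕜 : Type*) [Field 𝕜] {H : Type*} [Group H] (M : Subgroup H) : Type _ :=
  finGL 𝕜 (H ⧸ M) ⋊[clonerAction 𝕜 H (H ⧸ M)] H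

end

/-! Each halo product is a semidirect product of a lamp group with `H`, where the lamps live on an
`H`-set `W` (`H ⧸ M`, or `(H ⧸ M) × Fin r`). Let `X` be the given coupling of `H` and `K`. The coset
`gM` can be read, at a point `x`, as the `M`-orbit of `g⁻¹ • x`. Since `M`- and `N`-orbits agree,
this identifies `H ⧸ M` with `K ⧸ N` through a bijection `β x` that depends on `x` and is
equivariant along the cocycle: `β (h • x) (h w) = c(h, x) β x w`. Base cosets correspond to each
other.

Let the halo product over `H` act on `X × (W → Y)`: `H` acts diagonally and the lamps act on the
configuration only. Reindexing configurations by `β x` identifies this space with `X × (W' → Y)`, on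
which the halo product over `K` acts. Under this identification `h` acts at `(x, z)` exactly as
`c(h, x)` does, so the cocycle of the base group is unchanged. A lamp element over `W` becomes the
corresponding one over `W'`, transported by `β x`. Orbits therefore coincide, and freeness reduces
to that of the lamp group on configurations, because `H` acts freely on `X`. This is
`exists_isTame_coupling_of_halo`.

The fibre `Y` depends on the lamps. For wreath products it is the coupling space of `Γ` and `Λ`,
with product measure. In the other cases it is `ℕ → F` for a finite field `F`, with Haar measure: a
configuration is a linear map from the space with basis `W` to `ℕ → F`, on which linear
automorphisms act by precomposition. This is essentially free because each nonzero vector has a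
Haar-distributed, hence almost surely nonzero, image. Shufflers and jugglers are handled through
permutation matrices.

For integrability it suffices to treat generators, since `φ` of a sum of lengths is controlled after
rescaling. The position `β x w` is the translate of a base point by a cocycle value `f x`, so a lamp
there is a conjugate by `f x` of a lamp near the base point. What remains is to bound word lengths
in the halo product linearly: a transposition of `o` and `k o`, or an elementary automorphism
involving them, has length linear in that of `k` (`hasWord_finSwap`, `hasWord_elemGL`). Plain and
bounded orbit equivalence are run through the same argument with zero length functions. -/

noncomputable section

/-! ### Functions with controlled values in a countable set -/

/-- `f` has countable range and measurable fibres. -/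
structure DiscMeasurable {Ω B : Type*} [MeasurableSpace Ω] (f : Ω → B) : Prop where
  countable_range : (Set.range f).Countable
  measurableSet_fiber : ∀ b, MeasurableSet (f ⁻¹' {b})

namespace DiscMeasurable

variable {Ω Ω' B B₁ B₂ : Type*} [MeasurableSpace Ω] [MeasurableSpace Ω']

theorem measurableSet_preimage {f : Ω → B} (hf : DiscMeasurable f) (s : Set B) :
    MeasurableSet (f ⁻¹' s) := by
  have : f ⁻¹' s = ⋃ b ∈ s ∩ Set.range f, f ⁻¹' {b} := by
    ext x; simp
  rw [this]
  exact MeasurableSet.biUnion (hf.countable_range.mono Set.inter_subset_right)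
    fun b _ => hf.measurableSet_fiber b

theorem measurable_comp {T : Type*} [MeasurableSpace T] {f : Ω → B} (hf : DiscMeasurable f)
    (p : B → T) : Measurable fun x => p (f x) :=
  fun s _ => hf.measurableSet_preimage (p ⁻¹' s)

theorem const (b : B) : DiscMeasurable fun _ : Ω => b where
  countable_range := (Set.countable_singleton b).mono (by rintro _ ⟨_, rfl⟩; rfl)
  measurableSet_fiber b' := by
    by_cases h : b = b' <;> simp [h]

theorem comp {f : Ω → B} (hf : DiscMeasurable f) {p : Ω' → Ω} (hp : Measurable p) :
    DiscMeasurable fun x => f (p x) where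
  countable_range := hf.countable_range.mono (by rintro _ ⟨x, rfl⟩; exact ⟨p x, rfl⟩)
  measurableSet_fiber b := hp (hf.measurableSet_fiber b)

theorem prodMk {f₁ : Ω → B₁} {f₂ : Ω → B₂} (h₁ : DiscMeasurable f₁) (h₂ : DiscMeasurable f₂) :
    DiscMeasurable fun x => (f₁ x, f₂ x) where
  countable_range := (h₁.countable_range.prod h₂.countable_range).mono (by
    rintro _ ⟨x, rfl⟩; exact ⟨⟨x, rfl⟩, ⟨x, rfl⟩⟩)
  measurableSet_fiber b := by
    have : (fun x => (f₁ x, f₂ x)) ⁻¹' {b} = f₁ ⁻¹' {b.1} ∩ f₂ ⁻¹' {b.2} := by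
      ext x; simp [Prod.ext_iff]
    rw [this]
    exact (h₁.measurableSet_fiber _).inter (h₂.measurableSet_fiber _)

theorem map {f : Ω → B₁} (hf : DiscMeasurable f) (u : B₁ → B) :
    DiscMeasurable fun x => u (f x) where
  countable_range := (hf.countable_range.image u).mono (by
    rintro _ ⟨x, rfl⟩; exact ⟨f x, ⟨x, rfl⟩, rfl⟩)
  measurableSet_fiber b := hf.measurableSet_preimage (u ⁻¹' {b})

end DiscMeasurable

/-- `f` is a discrete measurable map whose `ℓ`-length is `φ`-integrable and which, if `fin` holds,
essentially takes finitely many values. -/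
structure TameFn {Ω B : Type*} [MeasurableSpace Ω] (φ : ℝ≥0 → ℝ≥0) (fin : Prop) (ℓ : B → ℕ)
    (μ : Measure Ω) (f : Ω → B) : Prop where
  disc : DiscMeasurable f
  integrable : ∃ C : ℝ≥0, 0 < C ∧ ∫⁻ x, ((φ ((ℓ (f x) : ℝ≥0) / C) : ℝ≥0) : ℝ≥0∞) ∂μ < ∞
  finite : fin → ∃ F : Set B, F.Finite ∧ ∀ᵐ x ∂μ, f x ∈ F

namespace TameFn

variable {Ω Ω' B B₁ B₂ : Type*} [MeasurableSpace Ω] [MeasurableSpace Ω'] {φ : ℝ≥0 → ℝ≥0}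
  {fin : Prop} {μ : Measure Ω} {μ' : Measure Ω'}

theorem const [IsFiniteMeasure μ] (ℓ : B → ℕ) (b : B) : TameFn φ fin ℓ μ fun _ : Ω => b where
  disc := .const b
  integrable := ⟨1, one_pos, by
    rw [lintegral_const]
    exact ENNReal.mul_lt_top ENNReal.coe_lt_top (measure_lt_top _ _)⟩
  finite _ := ⟨{b}, Set.finite_singleton b, by simp⟩

theorem comp {ℓ : B → ℕ} {f : Ω → B} (hf : TameFn φ fin ℓ μ f) {p : Ω' → Ω}
    (hp : MeasurePreserving p μ' μ) : TameFn φ fin ℓ μ' fun x => f (p x) where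
  disc := hf.disc.comp hp.measurable
  integrable := by
    obtain ⟨C, hC, h⟩ := hf.integrable
    refine ⟨C, hC, ?_⟩
    rwa [hp.lintegral_comp (f := fun x => ((φ ((ℓ (f x) : ℝ≥0) / C) : ℝ≥0) : ℝ≥0∞))
      (hf.disc.measurable_comp fun b => ((φ ((ℓ b : ℝ≥0) / C) : ℝ≥0) : ℝ≥0∞))]
  finite h := by
    obtain ⟨F, hF, hx⟩ := hf.finite h
    exact ⟨F, hF, hp.quasiMeasurePreserving.ae hx⟩

/-- No subadditivity of `φ` is needed: a sum of three terms is at most three times the largest, and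
the factor 3 goes into the scaling constant. Monotonicity then bounds `φ` by its value at one of the
three terms, hence by the sum of the three values. -/
theorem map₂ [IsFiniteMeasure μ] (hφ : Monotone φ) {ℓ₁ : B₁ → ℕ} {ℓ₂ : B₂ → ℕ} {ℓ : B → ℕ}
    {f₁ : Ω → B₁} {f₂ : Ω → B₂} (h₁ : TameFn φ fin ℓ₁ μ f₁) (h₂ : TameFn φ fin ℓ₂ μ f₂)
    (u : B₁ → B₂ → B) (hu : ∃ C : ℕ, ∀ a b, ℓ (u a b) ≤ C * (ℓ₁ a + ℓ₂ b + 1)) :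
    TameFn φ fin ℓ μ fun x => u (f₁ x) (f₂ x) where
  disc := (h₁.disc.prodMk h₂.disc).map fun p => u p.1 p.2
  integrable := by
    obtain ⟨C, hC⟩ := hu
    obtain ⟨C₁, hC₁, i₁⟩ := h₁.integrable
    obtain ⟨C₂, hC₂, i₂⟩ := h₂.integrable
    -- The 3 comes from comparing a sum of three terms with their maximum, and the `+ 1` next to it
    -- keeps the constant positive when `C = 0`. The second factor dominates each of `C₁`, `C₂` and
    -- 1.
    refine ⟨(3 * C + 1) * (C₁ + C₂ + 1), by positivity, ?_⟩
    have key : ∀ a b, φ ((ℓ (u a b) : ℝ≥0) / ((3 * C + 1) * (C₁ + C₂ + 1))) ≤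
        φ (ℓ₁ a / C₁) + φ (ℓ₂ b / C₂) + φ 1 := by
      intro a b
      have hl : (ℓ (u a b) : ℝ≥0) ≤ C * (ℓ₁ a + ℓ₂ b + 1) := by exact_mod_cast hC a b
      have le : ∀ m D : ℝ≥0, 0 < D → D ≤ C₁ + C₂ + 1 → (ℓ₁ a : ℝ≥0) ≤ m → (ℓ₂ b : ℝ≥0) ≤ m →
          1 ≤ m → (ℓ (u a b) : ℝ≥0) / ((3 * C + 1) * (C₁ + C₂ + 1)) ≤ m / D := by
        intro m D hD hDC h1 h2 h3
        rw [div_le_div_iff₀ (by positivity) hD]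
        calc (ℓ (u a b) : ℝ≥0) * D ≤ (C * (m + m + m)) * (C₁ + C₂ + 1) := by
              gcongr
              exact hl.trans (by gcongr)
          _ ≤ m * ((3 * C + 1) * (C₁ + C₂ + 1)) := by
              have : (C : ℝ≥0) * (m + m + m) ≤ m * (3 * C + 1) := by
                calc (C : ℝ≥0) * (m + m + m) = m * (3 * C) := by ring
                  _ ≤ m * (3 * C + 1) := by gcongr; simp
              calc _ ≤ (m * (3 * C + 1)) * (C₁ + C₂ + 1) := by gcongr
                _ = _ := by ring
      rcases le_total (ℓ₁ a : ℝ≥0) (ℓ₂ b) with h | h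
      · rcases le_total (ℓ₂ b : ℝ≥0) 1 with h' | h'
        · have := le 1 1 one_pos (by simp) (h.trans h') h' le_rfl
          rw [div_one] at this
          exact (hφ this).trans le_add_self
        · exact (hφ (le (ℓ₂ b) C₂ hC₂ (le_add_self.trans le_self_add) h le_rfl h')).trans
            (le_add_self.trans le_self_add)
      · rcases le_total (ℓ₁ a : ℝ≥0) 1 with h' | h'
        · have := le 1 1 one_pos (by simp) h' (h.trans h') le_rfl
          rw [div_one] at this
          exact (hφ this).trans le_add_self
        · exact (hφ (le (ℓ₁ a) C₁ hC₁ (le_self_add.trans le_self_add) le_rfl h h')).trans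
            (le_self_add.trans le_self_add)
    refine lt_of_le_of_lt (lintegral_mono (g := fun x =>
      (φ (ℓ₁ (f₁ x) / C₁) : ℝ≥0∞) + (φ (ℓ₂ (f₂ x) / C₂) : ℝ≥0∞) + (φ 1 : ℝ≥0∞)) fun x => ?_) ?_
    · exact (ENNReal.coe_le_coe.2 (key (f₁ x) (f₂ x))).trans_eq (by simp only [ENNReal.coe_add])
    · have m₁ : Measurable fun x => (φ (ℓ₁ (f₁ x) / C₁) : ℝ≥0∞) :=
        h₁.disc.measurable_comp fun b => (φ (ℓ₁ b / C₁) : ℝ≥0∞)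
      rw [lintegral_add_right _ measurable_const, lintegral_add_left m₁, lintegral_const]
      exact ENNReal.add_lt_top.2 ⟨ENNReal.add_lt_top.2 ⟨i₁, i₂⟩,
        ENNReal.mul_lt_top ENNReal.coe_lt_top (measure_lt_top _ _)⟩
  finite h := by
    obtain ⟨F₁, hF₁, hx₁⟩ := h₁.finite h
    obtain ⟨F₂, hF₂, hx₂⟩ := h₂.finite h
    refine ⟨Set.image2 u F₁ F₂, hF₁.image2 _ hF₂, ?_⟩
    filter_upwards [hx₁, hx₂] with x a b
    exact Set.mem_image2_of_mem a b

theorem map [IsFiniteMeasure μ] (hφ : Monotone φ) {ℓ₁ : B₁ → ℕ} {ℓ : B → ℕ}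
    {f : Ω → B₁} (hf : TameFn φ fin ℓ₁ μ f) (u : B₁ → B)
    (hu : ∃ C : ℕ, ∀ a, ℓ (u a) ≤ C * (ℓ₁ a + 1)) : TameFn φ fin ℓ μ fun x => u (f x) := by
  obtain ⟨C, hC⟩ := hu
  exact map₂ hφ hf (const (fun _ : Unit => 0) ()) (fun a _ => u a) ⟨C, fun a _ => by simpa using hC a⟩

end TameFn

/-- A length function: subadditive and symmetric. -/
structure IsGauge {G : Type*} [Group G] (ℓ : G → ℕ) : Prop where
  mul_le : ∀ a b, ℓ (a * b) ≤ ℓ a + ℓ b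
  inv_le : ∀ a, ℓ a⁻¹ ≤ ℓ a

namespace IsGauge
variable {G : Type*} [Group G] {ℓ : G → ℕ}

theorem zero : IsGauge (fun _ : G => 0) := ⟨by simp, by simp⟩

end IsGauge

namespace TameFn
variable {Ω G : Type*} [MeasurableSpace Ω] [Group G] {φ : ℝ≥0 → ℝ≥0}
  {fin : Prop} {μ : Measure Ω} {ℓ : G → ℕ} [IsFiniteMeasure μ]

theorem mul (hφ : Monotone φ) (hℓ : IsGauge ℓ) {f g : Ω → G} (hf : TameFn φ fin ℓ μ f)
    (hg : TameFn φ fin ℓ μ g) : TameFn φ fin ℓ μ fun x => f x * g x :=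
  map₂ hφ hf hg (· * ·) ⟨1, fun a b => by have := hℓ.mul_le a b; omega⟩

theorem inv (hφ : Monotone φ) (hℓ : IsGauge ℓ) {f : Ω → G} (hf : TameFn φ fin ℓ μ f) :
    TameFn φ fin ℓ μ fun x => (f x)⁻¹ :=
  map hφ hf (·⁻¹) ⟨1, fun a => by have := hℓ.inv_le a; omega⟩

end TameFn

/-! ### Word lengths as length functions -/

section wordLength
variable {G : Type*} [Group G]

theorem wordLength_prod_le {S : Set G} {w : List G} (hw : ∀ s ∈ w, s ∈ S ∨ s⁻¹ ∈ S) :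
    wordLength S w.prod ≤ w.length :=
  Nat.sInf_le ⟨w, rfl, hw, rfl⟩

theorem exists_word {S : Set G} (hS : Subgroup.closure S = ⊤) (g : G) :
    ∃ w : List G, w.length = wordLength S g ∧ (∀ s ∈ w, s ∈ S ∨ s⁻¹ ∈ S) ∧ w.prod = g := by
  refine Nat.sInf_mem (s := {n | ∃ w : List G, w.length = n ∧ (∀ s ∈ w, s ∈ S ∨ s⁻¹ ∈ S) ∧
    w.prod = g}) ?_
  have hg : g ∈ (Subgroup.closure S).toSubmonoid := hS ▸ Subgroup.mem_top g
  rw [Subgroup.closure_toSubmonoid] at hg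
  obtain ⟨w, hw, h⟩ := Submonoid.exists_list_of_mem_closure hg
  exact ⟨w.length, w, rfl, fun s hs => by simpa using hw s hs, h⟩

theorem isGauge_wordLength {S : Set G} (hS : Subgroup.closure S = ⊤) :
    IsGauge (wordLength S) where
  mul_le a b := by
    obtain ⟨v, hv, hv', rfl⟩ := exists_word hS a
    obtain ⟨w, hw, hw', rfl⟩ := exists_word hS b
    rw [← hv, ← hw, ← List.prod_append, ← List.length_append]
    exact wordLength_prod_le fun s hs => (List.mem_append.1 hs).elim (hv' s) (hw' s)
  inv_le a := by
    obtain ⟨v, hv, hv', rfl⟩ := exists_word hS a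
    rw [← hv, List.prod_inv_reverse]
    refine (wordLength_prod_le fun s hs => ?_).trans (by simp)
    simp only [List.mem_reverse, List.mem_map] at hs
    obtain ⟨t, ht, rfl⟩ := hs
    simpa using (hv' t ht).symm

theorem wordLength_map_le {G' : Type*} [Group G'] (f : G →* G') {S : Set G} {S' : Set G'}
    (hS : Subgroup.closure S = ⊤) (hf : ∀ s ∈ S, f s ∈ S') (g : G) :
    wordLength S' (f g) ≤ wordLength S g := by
  obtain ⟨w, hw, hw', rfl⟩ := exists_word hS g
  rw [← hw, map_list_prod]
  refine (wordLength_prod_le fun s hs => ?_).trans (by simp)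
  obtain ⟨t, ht, rfl⟩ := List.mem_map.1 hs
  rcases hw' t ht with h | h
  · exact .inl (hf _ h)
  · exact .inr (by simpa using hf _ h)

end wordLength

/-! ### Strict couplings -/

/-- Actions of `H` and `K` by measure-preserving maps, free and with the same orbits everywhere. -/
structure IsStrictCoupling (H K : Type*) {X : Type*} [Group H] [Group K] [MulAction H X]
    [MulAction K X] [MeasurableSpace X] (μ : Measure X) : Prop where
  mpLeft : ∀ h : H, MeasurePreserving (fun x : X => h • x) μ μ
  mpRight : ∀ k : K, MeasurePreserving (fun x : X => k • x) μ μ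
  freeLeft : ∀ (x : X) (h : H), h • x = x → h = 1
  freeRight : ∀ (x : X) (k : K), k • x = x → k = 1
  exists_right : ∀ (h : H) (x : X), ∃ k : K, h • x = k • x
  exists_left : ∀ (k : K) (x : X), ∃ h : H, k • x = h • x

namespace IsStrictCoupling

variable {H K X : Type*} [Group H] [Group K] [MulAction H X] [MulAction K X] [MeasurableSpace X]
  {μ : Measure X}

theorem symm (s : IsStrictCoupling H K μ) : IsStrictCoupling K H μ :=
  ⟨s.mpRight, s.mpLeft, s.freeRight, s.freeLeft, s.exists_left, s.exists_right⟩

theorem cocycle_smul (s : IsStrictCoupling H K μ) (h : H) (x : X) :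
    cocycle H K h x • x = h • x := by
  rw [cocycle, dif_pos (s.exists_right h x)]
  exact (s.exists_right h x).choose_spec.symm

theorem smul_right_inj (s : IsStrictCoupling H K μ) {k k' : K} {x : X} (h : k • x = k' • x) :
    k = k' := by
  have := s.freeRight x (k'⁻¹ * k) (by rw [mul_smul, h, inv_smul_smul])
  exact (inv_mul_eq_one.1 this).symm

theorem cocycle_eq (s : IsStrictCoupling H K μ) {h : H} {k : K} {x : X} (e : h • x = k • x) :
    cocycle H K h x = k :=
  s.smul_right_inj (by rw [s.cocycle_smul, e])

theorem cocycle_mul (s : IsStrictCoupling H K μ) (h h' : H) (x : X) :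
    cocycle H K (h * h') x = cocycle H K h (h' • x) * cocycle H K h' x :=
  s.cocycle_eq (by rw [mul_smul, mul_smul, s.cocycle_smul h' x, s.cocycle_smul])

theorem cocycle_one (s : IsStrictCoupling H K μ) (x : X) : cocycle H K 1 x = 1 :=
  s.cocycle_eq (by simp)

theorem cocycle_cocycle (s : IsStrictCoupling H K μ) (h : H) (x : X) :
    cocycle K H (cocycle H K h x) x = h :=
  s.symm.cocycle_eq (s.cocycle_smul h x)

/-- By freeness, the fibre over `k` is the coincidence set of the Borel maps `h • ·` and `k • ·`,
which is Borel in a standard Borel space. -/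
theorem discMeasurable_cocycle [StandardBorelSpace X] [Countable K] (s : IsStrictCoupling H K μ)
    (h : H) : DiscMeasurable (cocycle H K h : X → K) where
  countable_range := Set.to_countable _
  measurableSet_fiber k := by
    have : (cocycle H K h : X → K) ⁻¹' {k} = {x | h • x = k • x} := by
      ext x
      refine ⟨fun e => ?_, fun e => s.cocycle_eq e⟩
      rw [Set.mem_preimage, Set.mem_singleton_iff] at e
      rw [Set.mem_ofPred_eq, ← e, s.cocycle_smul]
    rw [this]
    exact measurableSet_eq_fun (s.mpLeft h).measurable (s.mpRight k).measurable

end IsStrictCoupling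

/-! ### Restriction to invariant conull sets -/

theorem MeasureTheory.MeasurePreserving.subtype {X : Type*} [MeasurableSpace X] {μ : Measure X}
    {T : X → X} (hT : MeasurePreserving T μ μ) {s : Set X} (hs : MeasurableSet s)
    (hinv : ∀ x, T x ∈ s ↔ x ∈ s) :
    MeasurePreserving (fun x : s => (⟨T x, (hinv x).2 x.2⟩ : s))
      (μ.comap Subtype.val) (μ.comap Subtype.val) where
  measurable := (hT.measurable.comp measurable_subtype_coe).subtype_mk
  map_eq := by
    ext t ht
    have hm : Measurable fun x : s => (⟨T x, (hinv x).2 x.2⟩ : s) :=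
      (hT.measurable.comp measurable_subtype_coe).subtype_mk
    rw [Measure.map_apply hm ht, comap_subtype_coe_apply hs, comap_subtype_coe_apply hs,
      ← hT.measure_preimage ((MeasurableEmbedding.subtype_coe hs).measurableSet_image.2
        ht).nullMeasurableSet]
    congr 1
    ext x
    constructor
    · rintro ⟨y, hy, rfl⟩
      exact ⟨_, hy, rfl⟩
    · rintro ⟨y, hy, e⟩
      have hx : x ∈ s := (hinv x).1 (e ▸ y.2)
      refine ⟨⟨x, hx⟩, ?_, rfl⟩
      have : (⟨T x, (hinv x).2 hx⟩ : s) = y := Subtype.ext e.symm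
      simpa [this] using hy

section restrict

variable {G X : Type*} [Group G] [MulAction G X]

/-- Restriction of an action to an invariant subset. -/
abbrev MulAction.restrictSet (s : Set X) (hs : ∀ (g : G) (x : X), x ∈ s → g • x ∈ s) :
    MulAction G s where
  smul g x := ⟨g • x.1, hs g x x.2⟩
  one_smul x := Subtype.ext (one_smul G x.1)
  mul_smul g g' x := Subtype.ext (mul_smul g g' x.1)

theorem smul_mem_iff_of_forall {s : Set X} (hs : ∀ (g : G) (x : X), x ∈ s → g • x ∈ s) (g : G)
    (x : X) : g • x ∈ s ↔ x ∈ s :=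
  ⟨fun h => by simpa using hs g⁻¹ _ h, hs g x⟩

end restrict

/-- Every coupling restricts to a strict coupling on a conull invariant Borel subset. -/
theorem OECoupling.exists_strict {H K : Type*} [Group H] [Group K] [Countable H] [Countable K]
    (c : OECoupling H K) (M : Subgroup H) (N : Subgroup K)
    (hMN : ∀ᵐ x ∂c.μ, MulAction.orbit M x = MulAction.orbit N x) :
    ∃ (c' : OECoupling H K) (e : c'.X → c.X), IsStrictCoupling H K c'.μ ∧
      (∀ (m : H) (x : c'.X), m ∈ M → ∃ n ∈ N, m • x = n • x) ∧
      (∀ (n : K) (x : c'.X), n ∈ N → ∃ m ∈ M, n • x = m • x) ∧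
      MeasurePreserving e c'.μ c.μ ∧ MeasurableEmbedding e ∧
      (∀ (h : H) (x : c'.X), cocycle H K h (e x) = cocycle H K h x) ∧
      (∀ (k : K) (x : c'.X), cocycle K H k (e x) = cocycle K H k x) := by
  set P : c.X → Prop := fun x => ((∀ h : H, h • x = x → h = 1) ∧ (∀ k : K, k • x = x → k = 1)) ∧
    ((∀ h : H, ∃ k : K, h • x = k • x) ∧ (∀ k : K, ∃ h : H, k • x = h • x)) ∧
    ((∀ m : M, ∃ n : N, (m : H) • x = (n : K) • x) ∧
      (∀ n : N, ∃ m : M, (n : K) • x = (m : H) • x)) with hP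
  have mH : ∀ h : H, Measurable fun x : c.X => h • x := fun h =>
    (c.freeLeft.measurePreserving h).measurable
  have mK : ∀ k : K, Measurable fun x : c.X => k • x := fun k =>
    (c.freeRight.measurePreserving k).measurable
  have hPm : MeasurableSet {x | P x} := by
    have a1 : ∀ h : H, MeasurableSet {x : c.X | h • x = x → h = 1} := fun h => by
      by_cases e : h = 1
      · simp [e]
      · have : {x : c.X | h • x = x → h = 1} = {x | h • x = id x}ᶜ := by ext; simp [e]
        rw [this]
        exact (measurableSet_eq_fun (mH h) measurable_id).compl
    have a2 : ∀ k : K, MeasurableSet {x : c.X | k • x = x → k = 1} := fun h => by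
      by_cases e : h = 1
      · simp [e]
      · have : {x : c.X | h • x = x → h = 1} = {x | h • x = id x}ᶜ := by ext; simp [e]
        rw [this]
        exact (measurableSet_eq_fun (mK h) measurable_id).compl
    have b : ∀ (h : H) (k : K), MeasurableSet {x : c.X | h • x = k • x} := fun h k =>
      measurableSet_eq_fun (mH h) (mK k)
    have b' : ∀ (h : H) (k : K), MeasurableSet {x : c.X | k • x = h • x} := fun h k =>
      measurableSet_eq_fun (mK k) (mH h)
    have e : {x | P x} = (((⋂ h : H, {x : c.X | h • x = x → h = 1}) ∩
        (⋂ k : K, {x : c.X | k • x = x → k = 1})) ∩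
        (((⋂ h : H, ⋃ k : K, {x : c.X | h • x = k • x}) ∩
          (⋂ k : K, ⋃ h : H, {x : c.X | k • x = h • x})) ∩
        ((⋂ h : M, ⋃ k : N, {x : c.X | (h : H) • x = (k : K) • x}) ∩
          (⋂ k : N, ⋃ h : M, {x : c.X | (k : K) • x = (h : H) • x})))) := by
      ext x
      simp only [hP, Set.mem_ofPred_eq, Set.mem_inter_iff, Set.mem_iInter, Set.mem_iUnion]
    rw [e]
    exact ((MeasurableSet.iInter a1).inter (MeasurableSet.iInter a2)).inter
      (((MeasurableSet.iInter fun h => MeasurableSet.iUnion fun k => b h k).inter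
        (MeasurableSet.iInter fun k => MeasurableSet.iUnion fun h => b' h k)).inter
      ((MeasurableSet.iInter fun h : M => MeasurableSet.iUnion fun k : N => b h k).inter
        (MeasurableSet.iInter fun k : N => MeasurableSet.iUnion fun h : M => b' h k)))
  have hPae : ∀ᵐ x ∂c.μ, P x := by
    filter_upwards [c.freeLeft.essentiallyFree, c.freeRight.essentiallyFree, c.orbit_eq, hMN]
      with x h1 h2 h3 h4
    refine ⟨⟨h1, h2⟩, ⟨fun h => ?_, fun k => ?_⟩, ⟨fun m => ?_, fun n => ?_⟩⟩
    · have : h • x ∈ MulAction.orbit K x := h3 ▸ MulAction.mem_orbit x h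
      obtain ⟨k, hk⟩ := this
      exact ⟨k, hk.symm⟩
    · have : k • x ∈ MulAction.orbit H x := h3 ▸ MulAction.mem_orbit x k
      obtain ⟨k, hk⟩ := this
      exact ⟨k, hk.symm⟩
    · have : m • x ∈ MulAction.orbit N x := h4 ▸ MulAction.mem_orbit x m
      obtain ⟨k, hk⟩ := this
      exact ⟨k, hk.symm⟩
    · have : n • x ∈ MulAction.orbit M x := h4 ▸ MulAction.mem_orbit x n
      obtain ⟨k, hk⟩ := this
      exact ⟨k, hk.symm⟩
  -- The largest `H`-invariant subset of the good set. It is conull because `H` is countable and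
  -- preserves the measure.
  set s : Set c.X := {x | ∀ h : H, P (h • x)} with hs
  have hsP : ∀ x ∈ s, P x := fun x hx => by simpa using hx 1
  have hsm : MeasurableSet s := by
    have : s = ⋂ h : H, (fun x => h • x) ⁻¹' {x | P x} := by ext x; simp [hs]
    rw [this]
    exact MeasurableSet.iInter fun h => mH h hPm
  have hsae : ∀ᵐ x ∂c.μ, x ∈ s := by
    rw [hs]
    exact ae_all_iff.2 fun h => (c.freeLeft.measurePreserving h).quasiMeasurePreserving.ae hPae
  have sH : ∀ (h : H) (x : c.X), x ∈ s → h • x ∈ s := fun h x hx h' => by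
    rw [← mul_smul]; exact hx _
  -- At a good point every `K`-translate is an `H`-translate, so `H`-invariance yields
  -- `K`-invariance.
  have sK : ∀ (k : K) (x : c.X), x ∈ s → k • x ∈ s := fun k x hx => by
    obtain ⟨h, e⟩ := (hsP x hx).2.1.2 k
    rw [e]; exact sH h x hx
  let : MulAction H s := MulAction.restrictSet s sH
  let : MulAction K s := MulAction.restrictSet s sK
  have hemb : MeasurableEmbedding (Subtype.val : s → c.X) := MeasurableEmbedding.subtype_coe hsm
  have hmp : MeasurePreserving (Subtype.val : s → c.X) (c.μ.comap Subtype.val) c.μ :=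
    ⟨measurable_subtype_coe, by
      rw [map_comap_subtype_coe hsm, Measure.restrict_eq_self_of_ae_mem hsae]⟩
  have hstrict : IsStrictCoupling H K (c.μ.comap (Subtype.val : s → c.X)) :=
    { mpLeft := fun h => (c.freeLeft.measurePreserving h).subtype hsm (smul_mem_iff_of_forall sH h)
      mpRight := fun h =>
        (c.freeRight.measurePreserving h).subtype hsm (smul_mem_iff_of_forall sK h)
      freeLeft := fun x h e => (hsP x x.2).1.1 h (congrArg Subtype.val e)
      freeRight := fun x h e => (hsP x x.2).1.2 h (congrArg Subtype.val e)
      exists_right := fun h x => by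
        obtain ⟨k, e⟩ := (hsP x x.2).2.1.1 h
        exact ⟨k, Subtype.ext e⟩
      exists_left := fun h x => by
        obtain ⟨k, e⟩ := (hsP x x.2).2.1.2 h
        exact ⟨k, Subtype.ext e⟩ }
  have : IsProbabilityMeasure (c.μ.comap (Subtype.val : s → c.X)) := ⟨by
    have := hmp.measure_preimage (MeasurableSet.univ.nullMeasurableSet)
    rwa [Set.preimage_univ, measure_univ (μ := c.μ)] at this⟩
  have : StandardBorelSpace s := hsm.standardBorel
  refine ⟨{ X := s
            μ := c.μ.comap Subtype.val
            freeLeft := ⟨hstrict.mpLeft, .of_forall hstrict.freeLeft⟩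
            freeRight := ⟨hstrict.mpRight, .of_forall hstrict.freeRight⟩
            orbit_eq := .of_forall fun x => ?_ }, Subtype.val, hstrict, ?_, ?_, hmp, hemb, ?_, ?_⟩
  · ext y
    constructor
    · rintro ⟨h, rfl⟩
      obtain ⟨k, e⟩ := hstrict.exists_right h x
      exact ⟨k, e.symm⟩
    · rintro ⟨h, rfl⟩
      obtain ⟨k, e⟩ := hstrict.exists_left h x
      exact ⟨k, e.symm⟩
  · intro m x hm
    obtain ⟨n, e⟩ := (hsP x x.2).2.2.1 ⟨m, hm⟩
    exact ⟨n, n.2, Subtype.ext e⟩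
  · intro m x hm
    obtain ⟨n, e⟩ := (hsP x x.2).2.2.2 ⟨m, hm⟩
    exact ⟨n, n.2, Subtype.ext e⟩
  · intro h x
    have hx : ∃ k : K, h • (x : c.X) = k • (x : c.X) := (hsP x x.2).2.1.1 h
    refine (hstrict.cocycle_eq (Subtype.ext ?_)).symm
    rw [cocycle, dif_pos hx]
    exact hx.choose_spec
  · intro h x
    have hx : ∃ k : H, h • (x : c.X) = k • (x : c.X) := (hsP x x.2).2.1.2 h
    refine (hstrict.symm.cocycle_eq (Subtype.ext ?_)).symm
    rw [cocycle, dif_pos hx]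
    exact hx.choose_spec

/-! ### Couplings with controlled cocycles -/

/-- The length functions used on a group: word lengths for finite generating sets (`b = true`), or
the zero function (`b = false`). -/
def IsAdmissibleGauge (b : Bool) {G : Type*} [Group G] (ℓ : G → ℕ) : Prop :=
  if b then ∃ S : Set G, S.Finite ∧ Subgroup.closure S = ⊤ ∧ ℓ = wordLength S else ℓ = fun _ => 0

theorem IsAdmissibleGauge.isGauge {b : Bool} {G : Type*} [Group G] {ℓ : G → ℕ}
    (h : IsAdmissibleGauge b ℓ) : IsGauge ℓ := by
  cases b
  · rw [show ℓ = fun _ => 0 from h]; exact .zero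
  · obtain ⟨S, _, hS, rfl⟩ := h
    exact isGauge_wordLength hS

/-- The conditions of `TameFn` on the values of a function. -/
def ValueBound {Ω B : Type*} [MeasurableSpace Ω] (φ : ℝ≥0 → ℝ≥0) (fin : Prop) (ℓ : B → ℕ)
    (μ : Measure Ω) (f : Ω → B) : Prop :=
  (∃ C : ℝ≥0, 0 < C ∧ ∫⁻ x, ((φ ((ℓ (f x) : ℝ≥0) / C) : ℝ≥0) : ℝ≥0∞) ∂μ < ∞) ∧
    (fin → ∃ F : Set B, F.Finite ∧ ∀ᵐ x ∂μ, f x ∈ F)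

namespace OECoupling

variable {H K : Type*} [Group H] [Group K]

/-- Both cocycles have bounded values, for admissible length functions. -/
def IsTame (c : OECoupling H K) (b : Bool) (φ ψ : ℝ≥0 → ℝ≥0) (fin : Prop) : Prop :=
  ∃ (ℓH : H → ℕ) (ℓK : K → ℕ), IsAdmissibleGauge b ℓH ∧ IsAdmissibleGauge b ℓK ∧
    (∀ h, ValueBound φ fin ℓK c.μ (c.cocycleLeft h)) ∧
    (∀ k, ValueBound ψ fin ℓH c.μ (c.cocycleRight k))

theorem isIntegrable_iff (c : OECoupling H K) (φ ψ : ℝ≥0 → ℝ≥0) :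
    c.IsIntegrable φ ψ ↔ c.IsTame true φ ψ False := by
  constructor
  · rintro ⟨⟨S, hS, hS', h⟩, ⟨T, hT, hT', h'⟩⟩
    exact ⟨wordLength T, wordLength S, ⟨T, hT, hT', rfl⟩, ⟨S, hS, hS', rfl⟩,
      fun a => ⟨h a, False.elim⟩, fun a => ⟨h' a, False.elim⟩⟩
  · rintro ⟨_, _, ⟨T, hT, hT', rfl⟩, ⟨S, hS, hS', rfl⟩, h, h'⟩
    exact ⟨⟨S, hS, hS', fun a => (h a).1⟩, ⟨T, hT, hT', fun a => (h' a).1⟩⟩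

/-- With zero control functions the integrability requirement is void, so `fin := False` gives plain
orbit equivalence and `fin := True` gives the essentially bounded one. -/
theorem isTame_false_iff (c : OECoupling H K) (fin : Prop) :
    c.IsTame false (fun _ => 0) (fun _ => 0) fin ↔ (fin → c.IsLInftyCoupling) := by
  constructor
  · rintro ⟨_, _, _, _, h, h'⟩ hfin
    exact ⟨fun a => (h a).2 hfin, fun a => (h' a).2 hfin⟩
  · intro h
    exact ⟨fun _ => 0, fun _ => 0, rfl, rfl, fun a => ⟨⟨1, one_pos, by simp⟩, fun hf => (h hf).1 a⟩,
      fun a => ⟨⟨1, one_pos, by simp⟩, fun hf => (h hf).2 a⟩⟩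

end OECoupling

/-- `f` need not be measurable: the cocycle of a general coupling is chosen arbitrarily off the good
set. The change of variables therefore relies on `e` being a measurable embedding. -/
theorem ValueBound.comp_embedding {Ω Ω' B : Type*} [MeasurableSpace Ω] [MeasurableSpace Ω']
    {φ : ℝ≥0 → ℝ≥0} {fin : Prop} {ℓ : B → ℕ} {μ : Measure Ω} {μ' : Measure Ω'} {f : Ω → B}
    (hf : ValueBound φ fin ℓ μ f) {e : Ω' → Ω} (he : MeasurePreserving e μ' μ)
    (he' : MeasurableEmbedding e) : ValueBound φ fin ℓ μ' fun x => f (e x) := by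
  obtain ⟨⟨C, hC, h⟩, h'⟩ := hf
  refine ⟨⟨C, hC, ?_⟩, fun hfin => ?_⟩
  · rwa [he.lintegral_comp_emb he' fun x => ((φ ((ℓ (f x) : ℝ≥0) / C) : ℝ≥0) : ℝ≥0∞)]
  · obtain ⟨F, hF, hx⟩ := h' hfin
    exact ⟨F, hF, he.quasiMeasurePreserving.ae hx⟩

theorem ValueBound.congr_ae {Ω B : Type*} [MeasurableSpace Ω]
    {φ : ℝ≥0 → ℝ≥0} {fin : Prop} {ℓ : B → ℕ} {μ : Measure Ω} {f g : Ω → B}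
    (hf : ValueBound φ fin ℓ μ f) (h : ∀ᵐ x ∂μ, g x = f x) : ValueBound φ fin ℓ μ g := by
  obtain ⟨⟨C, hC, hi⟩, h'⟩ := hf
  refine ⟨⟨C, hC, ?_⟩, fun hfin => ?_⟩
  · refine (lintegral_congr_ae ?_).trans_lt hi
    filter_upwards [h] with x hx
    rw [hx]
  · obtain ⟨F, hF, hx⟩ := h' hfin
    refine ⟨F, hF, ?_⟩
    filter_upwards [h, hx] with x e hx
    rwa [e]

theorem TameFn.valueBound {Ω B : Type*} [MeasurableSpace Ω] {φ : ℝ≥0 → ℝ≥0} {fin : Prop}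
    {ℓ : B → ℕ} {μ : Measure Ω} {f : Ω → B} (hf : TameFn φ fin ℓ μ f) : ValueBound φ fin ℓ μ f :=
  ⟨hf.integrable, hf.finite⟩

theorem ValueBound.tameFn {Ω B : Type*} [MeasurableSpace Ω] {φ : ℝ≥0 → ℝ≥0} {fin : Prop}
    {ℓ : B → ℕ} {μ : Measure Ω} {f : Ω → B} (hf : ValueBound φ fin ℓ μ f) (hd : DiscMeasurable f) :
    TameFn φ fin ℓ μ f :=
  ⟨hd, hf.1, hf.2⟩

/-- A strict coupling matching the subgroups `M` and `N`, with tame cocycles. -/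
structure IsTameStrictCoupling {H K : Type*} {X : Type*} [Group H] [Group K] [MulAction H X]
    [MulAction K X] [MeasurableSpace X] (M : Subgroup H) (N : Subgroup K) (φ ψ : ℝ≥0 → ℝ≥0)
    (fin : Prop) (ℓH : H → ℕ) (ℓK : K → ℕ) (μ : Measure X) : Prop
    extends IsStrictCoupling H K μ where
  exists_mem_right : ∀ (m : H) (x : X), m ∈ M → ∃ n ∈ N, m • x = n • x
  exists_mem_left : ∀ (n : K) (x : X), n ∈ N → ∃ m ∈ M, n • x = m • x
  tameLeft : ∀ h : H, TameFn φ fin ℓK μ (cocycle H K h : X → K)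
  tameRight : ∀ k : K, TameFn ψ fin ℓH μ (cocycle K H k : X → H)

theorem IsTameStrictCoupling.symm {H K : Type*} {X : Type*} [Group H] [Group K] [MulAction H X]
    [MulAction K X] [MeasurableSpace X] {M : Subgroup H} {N : Subgroup K} {φ ψ : ℝ≥0 → ℝ≥0}
    {fin : Prop} {ℓH : H → ℕ} {ℓK : K → ℕ} {μ : Measure X}
    (s : IsTameStrictCoupling M N φ ψ fin ℓH ℓK μ) :
    IsTameStrictCoupling N M ψ φ fin ℓK ℓH μ :=
  ⟨s.toIsStrictCoupling.symm, s.exists_mem_left, s.exists_mem_right, s.tameRight, s.tameLeft⟩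

theorem OECoupling.IsTame.exists_strict {H K : Type*} [Group H] [Group K] [Countable H]
    [Countable K] {c : OECoupling H K} {b : Bool} {φ ψ : ℝ≥0 → ℝ≥0} {fin : Prop}
    (hc : c.IsTame b φ ψ fin) (M : Subgroup H) (N : Subgroup K)
    (hMN : ∀ᵐ x ∂c.μ, MulAction.orbit M x = MulAction.orbit N x) :
    ∃ (c' : OECoupling H K) (ℓH : H → ℕ) (ℓK : K → ℕ), IsAdmissibleGauge b ℓH ∧
      IsAdmissibleGauge b ℓK ∧ IsTameStrictCoupling M N φ ψ fin ℓH ℓK c'.μ := by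
  obtain ⟨ℓH, ℓK, aH, aK, tH, tK⟩ := hc
  obtain ⟨c', e, s, hM, hN, he, he', eH, eK⟩ := c.exists_strict M N hMN
  refine ⟨c', ℓH, ℓK, aH, aK, ⟨s, hM, hN, fun h => ?_, fun k => ?_⟩⟩
  · have := (tH h).comp_embedding he he'
    simp only [cocycleLeft, eH] at this
    exact this.tameFn (s.discMeasurable_cocycle h)
  · have := (tK k).comp_embedding he he'
    simp only [cocycleRight, eK] at this
    exact this.tameFn (s.symm.discMeasurable_cocycle k)

/-! ### From generators to the whole group -/

section generators

variable {G G' Ω : Type*} [Group G] [Group G'] [MeasurableSpace Ω] {φ : ℝ≥0 → ℝ≥0}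
  {fin : Prop} {ℓ' : G' → ℕ} {μ : Measure Ω} [IsFiniteMeasure μ]

/-- If generators of `G` move points inside `G'`-orbits in a tame way, then so does `G`. -/
theorem exists_tameFn_of_closure (hφ : Monotone φ) (hℓ : IsGauge ℓ') (τ : G →* Equiv.Perm Ω)
    (τ' : G' →* Equiv.Perm Ω) (hτ : ∀ g, MeasurePreserving (τ g) μ μ) {S : Set G}
    (hS : Subgroup.closure S = ⊤)
    (h : ∀ g ∈ S, ∃ F : Ω → G', TameFn φ fin ℓ' μ F ∧ ∀ x, τ g x = τ' (F x) x) (g : G) :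
    ∃ F : Ω → G', TameFn φ fin ℓ' μ F ∧ ∀ x, τ g x = τ' (F x) x := by
  have hg : g ∈ Subgroup.closure S := hS ▸ Subgroup.mem_top g
  induction hg using Subgroup.closure_induction with
  | mem x hx => exact h x hx
  | one => exact ⟨fun _ => 1, .const _ _, by simp⟩
  | mul a b _ _ iha ihb =>
    obtain ⟨F, hF, hF'⟩ := iha
    obtain ⟨E, hE, hE'⟩ := ihb
    -- The cocycle identity `c(ab, x) = c(a, bx) c(b, x)`. Tameness survives the shift by `b`
    -- because `τ b` preserves the measure.
    refine ⟨fun x => F (τ b x) * E x, (hF.comp (hτ b)).mul hφ hℓ hE, fun x => ?_⟩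
    rw [map_mul, map_mul, Equiv.Perm.mul_apply, Equiv.Perm.mul_apply, ← hE', hF']
  | inv a _ iha =>
    obtain ⟨F, hF, hF'⟩ := iha
    refine ⟨fun x => (F (τ a⁻¹ x))⁻¹, (hF.comp (hτ a⁻¹)).inv hφ hℓ, fun x => ?_⟩
    rw [map_inv τ', Equiv.Perm.eq_inv_iff_eq, ← hF', ← Equiv.Perm.mul_apply, ← map_mul,
      mul_inv_cancel, map_one, Equiv.Perm.one_apply]

end generators

theorem cocycle_eq_of_free {A B X : Type*} [Group A] [Group B] [MulAction A X] [MulAction B X]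
    {a : A} {y : X} {b : B} (hfree : ∀ b : B, b • y = y → b = 1) (hab : a • y = b • y) :
    cocycle A B a y = b := by
  have hex : ∃ b : B, a • y = b • y := ⟨b, hab⟩
  rw [cocycle, dif_pos hex]
  have := hfree (b⁻¹ * hex.choose) (by rw [mul_smul, ← hex.choose_spec, hab, inv_smul_smul])
  exact (inv_mul_eq_one.1 this).symm

/-- Transport of an action given by a homomorphism to permutations along an equivalence. -/
abbrev MulAction.ofPermHom {G Ω X : Type*} [Group G] (τ : G →* Equiv.Perm Ω) (E : Ω ≃ X) :
    MulAction G X where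
  smul g y := E (τ g (E.symm y))
  one_smul y := by change E (τ 1 (E.symm y)) = y; simp
  mul_smul g g' y := by
    change E (τ (g * g') (E.symm y)) = E (τ g (E.symm (E (τ g' (E.symm y)))))
    simp

/-- Two essentially free actions on a standard probability space, each moving points inside the
orbits of the other in a tame way, give a coupling. -/
theorem exists_isTame_coupling {G G' Ω : Type*} [Group G] [Group G'] [MeasurableSpace Ω]
    [StandardBorelSpace Ω] {φ ψ : ℝ≥0 → ℝ≥0} {fin : Prop} {b : Bool} {ℓ : G → ℕ} {ℓ' : G' → ℕ}
    {μ : Measure Ω} [IsProbabilityMeasure μ] (aℓ : IsAdmissibleGauge b ℓ)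
    (aℓ' : IsAdmissibleGauge b ℓ') (τ : G →* Equiv.Perm Ω) (τ' : G' →* Equiv.Perm Ω)
    (hτ : ∀ g, MeasurePreserving (τ g) μ μ) (hτ' : ∀ g, MeasurePreserving (τ' g) μ μ)
    (hf : ∀ᵐ x ∂μ, ∀ g, τ g x = x → g = 1) (hf' : ∀ᵐ x ∂μ, ∀ g, τ' g x = x → g = 1)
    (h : ∀ g, ∃ F : Ω → G', TameFn φ fin ℓ' μ F ∧ ∀ x, τ g x = τ' (F x) x)
    (h' : ∀ g', ∃ F : Ω → G, TameFn ψ fin ℓ μ F ∧ ∀ x, τ' g' x = τ (F x) x) :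
    ∃ c : OECoupling G G', c.IsTame b φ ψ fin := by
  -- The space of a coupling must live in `Type`, whereas `Ω` may lie in any universe, so everything
  -- is transported to a Borel subset of the real line.
  obtain ⟨e, he⟩ := exists_measurableEmbedding_real Ω
  let E : Ω ≃ᵐ Set.range e := he.equivRange
  let _ : MulAction G (Set.range e) := MulAction.ofPermHom τ E.toEquiv
  let _ : MulAction G' (Set.range e) := MulAction.ofPermHom τ' E.toEquiv
  have sm : ∀ (g : G) (y : Set.range e), g • y = E (τ g (E.symm y)) := fun _ _ => rfl
  have sm' : ∀ (g : G') (y : Set.range e), g • y = E (τ' g (E.symm y)) := fun _ _ => rfl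
  have hE : MeasurePreserving E μ (μ.map E) := E.measurable.measurePreserving μ
  have hE' : MeasurePreserving E.symm (μ.map E) μ := hE.symm
  have mp : ∀ g : G, MeasurePreserving (fun y : Set.range e => g • y) (μ.map E) (μ.map E) :=
    fun g => hE.comp ((hτ g).comp hE')
  have mp' : ∀ g : G', MeasurePreserving (fun y : Set.range e => g • y) (μ.map E) (μ.map E) :=
    fun g => hE.comp ((hτ' g).comp hE')
  have fr : ∀ᵐ y ∂(μ.map E), ∀ g : G, g • y = y → g = 1 := by
    filter_upwards [hE'.quasiMeasurePreserving.ae hf] with y hy g hg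
    exact hy g (E.injective (hg.trans (E.apply_symm_apply y).symm))
  have fr' : ∀ᵐ y ∂(μ.map E), ∀ g : G', g • y = y → g = 1 := by
    filter_upwards [hE'.quasiMeasurePreserving.ae hf'] with y hy g hg
    exact hy g (E.injective (hg.trans (E.apply_symm_apply y).symm))
  have hpr : IsProbabilityMeasure (μ.map E) := Measure.isProbabilityMeasure_map E.measurable.aemeasurable
  have hsb : StandardBorelSpace (Set.range e) := he.measurableSet_range.standardBorel
  refine ⟨{ X := Set.range e
            μ := μ.map E
            freeLeft := ⟨mp, fr⟩
            freeRight := ⟨mp', fr'⟩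
            orbit_eq := .of_forall fun y => ?_ }, ℓ, ℓ', aℓ, aℓ', fun g => ?_, fun g => ?_⟩
  · ext z
    constructor
    · rintro ⟨g, rfl⟩
      obtain ⟨F, _, hF⟩ := h g
      exact ⟨F (E.symm y), by simp only [sm, sm', hF]⟩
    · rintro ⟨g, rfl⟩
      obtain ⟨F, _, hF⟩ := h' g
      exact ⟨F (E.symm y), by simp only [sm, sm', hF]⟩
  · obtain ⟨F, hF, hF'⟩ := h g
    refine (hF.comp hE').valueBound.congr_ae ?_
    filter_upwards [fr'] with y hy
    exact cocycle_eq_of_free hy (by simp only [sm, sm', hF'])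
  · obtain ⟨F, hF, hF'⟩ := h' g
    refine (hF.comp hE').valueBound.congr_ae ?_
    filter_upwards [fr] with y hy
    exact cocycle_eq_of_free hy (by simp only [sm, sm', hF'])

/-! ### Equivariant families of bijections -/

/-- A family of bijections `β x : W ≃ W'`, equivariant along the cocycle of a coupling, matching
finite systems of orbit representatives `o` and `o'`. -/
structure EquivariantFamily {H K X W W' I : Type*} [Group H] [Group K] [MulAction H X]
    [MulAction K X] (ρ : H →* Equiv.Perm W) (ρ' : K →* Equiv.Perm W') (o : I → W) (o' : I → W')
    (β : X → W ≃ W') : Prop where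
  equivariant : ∀ (h : H) (x : X) (w : W),
    β (h • x) (ρ h w) = ρ' (cocycle H K h x) (β x w)
  base : ∀ x i, β x (o i) = o' i
  cover : ∀ w, ∃ h i, w = ρ h (o i)
  cover' : ∀ w, ∃ k i, w = ρ' k (o' i)

namespace EquivariantFamily

variable {H K X W W' I : Type*} [Group H] [Group K] [MulAction H X] [MulAction K X]
  [MeasurableSpace X] {ρ : H →* Equiv.Perm W} {ρ' : K →* Equiv.Perm W'} {o : I → W} {o' : I → W'}
  {β : X → W ≃ W'} {μ : Measure X}

/-- The two cocycles invert each other at every point. Each `K`-translate of `x` is thus an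
`H`-translate whose cocycle value is the given element of `K`, and the equivariance relation can be
inverted. -/
theorem symm (hβ : EquivariantFamily ρ ρ' o o' β) (s : IsStrictCoupling H K μ) :
    EquivariantFamily ρ' ρ o' o fun x => (β x).symm where
  equivariant k x w := by
    rw [Equiv.symm_apply_eq, ← s.symm.cocycle_smul k x, hβ.equivariant, s.symm.cocycle_cocycle,
      Equiv.apply_symm_apply]
  base x i := by rw [Equiv.symm_apply_eq, hβ.base]
  cover := hβ.cover'
  cover' := hβ.cover

variable {M : Subgroup H} {N : Subgroup K} {φ ψ : ℝ≥0 → ℝ≥0} {fin : Prop} {ℓH : H → ℕ}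
  {ℓK : K → ℕ}

/-- If `w = h o_i`, applying equivariance at `h⁻¹ • x` gives `β x w = c(h, h⁻¹ x) o'_i`. The lift is
a cocycle composed with a measure-preserving map, hence tame. This is how the positions of
transported lamps are controlled. -/
theorem exists_lift (hβ : EquivariantFamily ρ ρ' o o' β)
    (s : IsTameStrictCoupling M N φ ψ fin ℓH ℓK μ) (w : W) :
    ∃ (i : I) (f : X → K), TameFn φ fin ℓK μ f ∧ ∀ x, β x w = ρ' (f x) (o' i) := by
  obtain ⟨h, i, rfl⟩ := hβ.cover w
  refine ⟨i, fun x => cocycle H K h (h⁻¹ • x), (s.tameLeft h).comp (s.mpLeft h⁻¹), fun x => ?_⟩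
  rw [← hβ.base (h⁻¹ • x) i, ← hβ.equivariant, smul_inv_smul]

theorem discMeasurable (hβ : EquivariantFamily ρ ρ' o o' β)
    (s : IsTameStrictCoupling M N φ ψ fin ℓH ℓK μ) (w : W) : DiscMeasurable fun x => β x w := by
  obtain ⟨i, f, hf, h⟩ := hβ.exists_lift s w
  simp only [h]
  exact hf.disc.map fun k => ρ' k (o' i)

end EquivariantFamily

/-! ### Skew products -/

theorem DiscMeasurable.measurable_eval {X W Y : Type*} [MeasurableSpace X] [MeasurableSpace Y]
    {f : X → W} (hf : DiscMeasurable f) : Measurable fun p : X × (W → Y) => p.2 (f p.1) := by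
  intro t ht
  have : (fun p : X × (W → Y) => p.2 (f p.1)) ⁻¹' t =
      ⋃ w ∈ Set.range f, (f ⁻¹' {w}) ×ˢ ((fun z : W → Y => z w) ⁻¹' t) := by
    ext ⟨x, z⟩
    simp only [Set.mem_preimage, Set.mem_iUnion, Set.mem_prod, Set.mem_singleton_iff, exists_prop]
    exact ⟨fun h => ⟨f x, ⟨x, rfl⟩, rfl, h⟩, fun ⟨w, _, e, h⟩ => e ▸ h⟩
  rw [this]
  exact MeasurableSet.biUnion hf.countable_range fun w _ =>
    (hf.measurableSet_fiber w).prod (measurable_pi_apply w ht)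

/-- Fibrewise reindexing of configurations. -/
def reindexEquiv {X W W' Y : Type*} [MeasurableSpace X] [MeasurableSpace Y] (β : X → W ≃ W')
    (h : ∀ w, DiscMeasurable fun x => β x w) (h' : ∀ w, DiscMeasurable fun x => (β x).symm w) :
    X × (W → Y) ≃ᵐ X × (W' → Y) where
  toFun p := (p.1, fun w => p.2 ((β p.1).symm w))
  invFun p := (p.1, fun w => p.2 (β p.1 w))
  left_inv p := by simp
  right_inv p := by simp
  measurable_toFun := measurable_fst.prodMk (measurable_pi_lambda _ fun w => (h' w).measurable_eval)
  measurable_invFun := measurable_fst.prodMk (measurable_pi_lambda _ fun w => (h w).measurable_eval)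

/-- The action of `G` on `X × Z` through `π : G →* H` and `τ : G →* Equiv.Perm Z`. -/
def skewHom {G H X Z : Type*} [Group G] [Group H] [MulAction H X] (π : G →* H)
    (τ : G →* Equiv.Perm Z) : G →* Equiv.Perm (X × Z) where
  toFun g := (MulAction.toPerm (π g)).prodCongr (τ g)
  map_one' := by ext x <;> simp
  map_mul' g g' := by ext x <;> simp [mul_smul]

section skew

variable {G G' H K X W W' Y I : Type*} [Group G] [Group G'] [Group H] [Group K] [MulAction H X]
  [MulAction K X] [MeasurableSpace X] [MeasurableSpace Y] {μ : Measure X}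
  {M : Subgroup H} {N : Subgroup K} {φ ψ : ℝ≥0 → ℝ≥0} {fin : Prop} {b : Bool} {ℓH : H → ℕ}
  {ℓK : K → ℕ} {ℓ : G → ℕ} {ℓ' : G' → ℕ} {ρ : H →* Equiv.Perm W} {ρ' : K →* Equiv.Perm W'}
  {o : I → W} {o' : I → W'} {β : X → W ≃ W'} {ν : Measure (W → Y)} {ν' : Measure (W' → Y)}

theorem measurePreserving_skewHom [IsProbabilityMeasure μ] [IsProbabilityMeasure ν] (s : IsStrictCoupling H K μ) (π : G →* H)
    (τ : G →* Equiv.Perm (W → Y)) (hτ : ∀ g, MeasurePreserving (τ g) ν ν) (g : G) :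
    MeasurePreserving (skewHom (X := X) π τ g) (μ.prod ν) (μ.prod ν) :=
  (s.mpLeft (π g)).prod (hτ g)

/-- The first coordinate of a fixed point already forces `π g = 1`, so only the kernel of `π` has to
act essentially freely on configurations. -/
theorem skewHom_free (s : IsStrictCoupling H K μ) (π : G →* H)
    (τ : G →* Equiv.Perm (W → Y)) (hf : ∀ᵐ z ∂ν, ∀ g, π g = 1 → τ g z = z → g = 1) :
    ∀ᵐ p ∂(μ.prod ν), ∀ g, skewHom (X := X) π τ g p = p → g = 1 := by
  filter_upwards [Measure.quasiMeasurePreserving_snd.ae hf] with p hp g hg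
  exact hp g (s.freeLeft p.1 _ (congrArg Prod.fst hg)) (congrArg Prod.snd hg)

variable [StandardBorelSpace X] [StandardBorelSpace Y] [Countable W]
  [IsProbabilityMeasure μ] [IsProbabilityMeasure ν] [IsProbabilityMeasure ν']

/-- Skew products over a coupling, matched by fibrewise reindexing, are coupled. -/
theorem exists_isTame_coupling_of_skew (hφ : Monotone φ) (hψ : Monotone ψ)
    (s : IsTameStrictCoupling M N φ ψ fin ℓH ℓK μ)
    (hβ : EquivariantFamily ρ ρ' o o' β) (aℓ : IsAdmissibleGauge b ℓ)
    (aℓ' : IsAdmissibleGauge b ℓ') (π : G →* H) (π' : G' →* K) (τ : G →* Equiv.Perm (W → Y))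
    (τ' : G' →* Equiv.Perm (W' → Y)) (hτ : ∀ g, MeasurePreserving (τ g) ν ν)
    (hτ' : ∀ g, MeasurePreserving (τ' g) ν' ν')
    (hν : ∀ x, MeasurePreserving (fun z : W → Y => fun w => z ((β x).symm w)) ν ν')
    (hf : ∀ᵐ z ∂ν, ∀ g, π g = 1 → τ g z = z → g = 1)
    (hf' : ∀ᵐ z ∂ν', ∀ g, π' g = 1 → τ' g z = z → g = 1)
    {S : Set G} {S' : Set G'} (hS : Subgroup.closure S = ⊤) (hS' : Subgroup.closure S' = ⊤)
    (h : ∀ g ∈ S, ∃ F : X × (W → Y) → G', TameFn φ fin ℓ' (μ.prod ν) F ∧ ∀ x z,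
      π' (F (x, z)) • x = π g • x ∧
      (fun w => τ g z ((β (π g • x)).symm w)) = τ' (F (x, z)) fun w => z ((β x).symm w))
    (h' : ∀ g ∈ S', ∃ F : X × (W' → Y) → G, TameFn ψ fin ℓ (μ.prod ν') F ∧ ∀ x z,
      π (F (x, z)) • x = π' g • x ∧
      (fun w => τ' g z (β (π' g • x) w)) = τ (F (x, z)) fun w => z (β x w)) :
    ∃ c : OECoupling G G', c.IsTame b φ ψ fin := by
  have m1 := hβ.discMeasurable s
  have m2 := (hβ.symm s.toIsStrictCoupling).discMeasurable s.symm
  -- `Θ` preserves the product measures, being a fibrewise measure-preserving map over the identity.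
  -- The action of `G'` is pulled back along it, so that both groups act on the same space.
  let Θ : X × (W → Y) ≃ᵐ X × (W' → Y) := reindexEquiv β m1 m2
  have hΘ : MeasurePreserving Θ (μ.prod ν) (μ.prod ν') :=
    (MeasurePreserving.id μ).skew_product (g := fun x (z : W → Y) w => z ((β x).symm w))
      (measurable_pi_lambda _ fun w => (m2 w).measurable_eval) (.of_forall fun x => (hν x).map_eq)
  let T : G →* Equiv.Perm (X × (W → Y)) := skewHom π τ
  let T₀ : G' →* Equiv.Perm (X × (W' → Y)) := skewHom π' τ'
  let T' : G' →* Equiv.Perm (X × (W → Y)) :=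
    (Θ.toEquiv.symm.permCongrHom : _ ≃* _).toMonoidHom.comp T₀
  have hT' : ∀ g p, T' g p = Θ.symm (T₀ g (Θ p)) := fun _ _ => rfl
  have mT : ∀ g, MeasurePreserving (T g) (μ.prod ν) (μ.prod ν) :=
    measurePreserving_skewHom s.toIsStrictCoupling π τ hτ
  have mT₀ : ∀ g, MeasurePreserving (T₀ g) (μ.prod ν') (μ.prod ν') :=
    measurePreserving_skewHom s.toIsStrictCoupling.symm π' τ' hτ'
  have mT' : ∀ g, MeasurePreserving (T' g) (μ.prod ν) (μ.prod ν) := fun g =>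
    (hΘ.symm Θ).comp ((mT₀ g).comp hΘ)
  refine exists_isTame_coupling aℓ aℓ' T T' mT mT' (skewHom_free s.toIsStrictCoupling π τ hf) ?_
    (exists_tameFn_of_closure hφ aℓ'.isGauge T T' mT hS fun g hg => ?_)
    (exists_tameFn_of_closure hψ aℓ.isGauge T' T mT' hS' fun g hg => ?_)
  · filter_upwards [hΘ.quasiMeasurePreserving.ae
      (skewHom_free s.toIsStrictCoupling.symm π' τ' hf')] with p hp g hg
    refine hp g ?_
    rw [hT', MeasurableEquiv.symm_apply_eq] at hg
    exact hg
  · obtain ⟨F, hF, hF'⟩ := h g hg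
    refine ⟨F, hF, fun p => ?_⟩
    obtain ⟨e1, e2⟩ := hF' p.1 p.2
    rw [hT', ← MeasurableEquiv.symm_apply_eq, MeasurableEquiv.symm_symm]
    exact Prod.ext e1.symm e2
  · obtain ⟨F, hF, hF'⟩ := h' g hg
    refine ⟨fun p => F (Θ p), hF.comp hΘ, fun p => ?_⟩
    obtain ⟨e1, e2⟩ := hF' p.1 (Θ p).2
    rw [hT']
    have e3 : (fun w => (Θ p).2 (β p.1 w)) = p.2 := by
      funext w
      exact congrArg p.2 ((β p.1).symm_apply_apply w)
    rw [e3] at e2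
    exact Prod.ext e1.symm e2

end skew

/-! ### Halo products -/

theorem SemidirectProduct.closure_inl_union_inr {A H : Type*} [Group A] [Group H]
    {r : H →* MulAut A} {T : Set A} {S : Set H} (hT : Subgroup.closure T = ⊤)
    (hS : Subgroup.closure S = ⊤) :
    Subgroup.closure ((inl '' T ∪ inr '' S : Set (A ⋊[r] H))) = ⊤ := by
  rw [Subgroup.closure_union, ← MonoidHom.map_closure, ← MonoidHom.map_closure, hT, hS, eq_top_iff]
  intro g _
  rw [← inl_left_mul_inr_right g]
  exact mul_mem (Subgroup.mem_sup_left ⟨_, Subgroup.mem_top _, rfl⟩)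
    (Subgroup.mem_sup_right ⟨_, Subgroup.mem_top _, rfl⟩)

section halo

open SemidirectProduct

variable {A B H K X W W' Y I : Type*} [Group A] [Group B] [Group H] [Group K] [MulAction H X]
  [MulAction K X] [MeasurableSpace X] [MeasurableSpace Y] {μ : Measure X} [IsProbabilityMeasure μ]
  {M : Subgroup H} {N : Subgroup K} {φ ψ : ℝ≥0 → ℝ≥0} {fin : Prop} {b : Bool} {ℓH : H → ℕ}
  {ℓK : K → ℕ} {r : H →* MulAut A} {r' : K →* MulAut B} {ℓ : A ⋊[r] H → ℕ} {ℓ' : B ⋊[r'] K → ℕ}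
  {ρ : H →* Equiv.Perm W} {ρ' : K →* Equiv.Perm W'}
  {o : I → W} {o' : I → W'} {β : X → W ≃ W'}
  {ν : Measure (W → Y)} {ν' : Measure (W' → Y)} [IsProbabilityMeasure ν]

/-- Only lamp generators need a separate hypothesis: on the base group the new cocycle is the old
one, depends on `x` alone, and stays tame because its length in the halo product is linearly bounded
by `ℓK`. -/
theorem exists_tameFn_generators (hφ : Monotone φ) (s : IsTameStrictCoupling M N φ ψ fin ℓH ℓK μ)
    (hβ : EquivariantFamily ρ ρ' o o' β) (hℓ' : ∃ C, ∀ k, ℓ' (inr k) ≤ C * (ℓK k + 1))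
    (τ : A ⋊[r] H →* Equiv.Perm (W → Y)) (τ' : B ⋊[r'] K →* Equiv.Perm (W' → Y))
    (hr : ∀ h z, τ (inr h) z = fun w => z (ρ h⁻¹ w))
    (hr' : ∀ k z, τ' (inr k) z = fun w => z (ρ' k⁻¹ w)) {T : Set A}
    (h : ∀ a ∈ T, ∃ F : X × (W → Y) → B,
      TameFn φ fin ℓ' (μ.prod ν) (fun p => (inl (F p) : B ⋊[r'] K)) ∧ ∀ x z,
      (fun w => τ (inl a) z ((β x).symm w)) = τ' (inl (F (x, z))) fun w => z ((β x).symm w)) :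
    ∀ g ∈ (inl '' T ∪ inr '' Set.univ : Set (A ⋊[r] H)), ∃ F : X × (W → Y) → B ⋊[r'] K,
      TameFn φ fin ℓ' (μ.prod ν) F ∧ ∀ x z,
      rightHom (F (x, z)) • x = rightHom g • x ∧
      (fun w => τ g z ((β (rightHom g • x)).symm w)) = τ' (F (x, z)) fun w => z ((β x).symm w) := by
  rintro _ (⟨a, ha, rfl⟩ | ⟨g, -, rfl⟩)
  · obtain ⟨F, hF, hF'⟩ := h a ha
    refine ⟨_, hF, fun x z => ⟨by simp, ?_⟩⟩
    rw [← hF', rightHom_inl, one_smul]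
  · refine ⟨fun p => inr (cocycle H K g p.1),
      ((s.tameLeft g).map hφ _ hℓ').comp measurePreserving_fst, fun x z => ⟨?_, ?_⟩⟩
    · rw [rightHom_inr, rightHom_inr, s.cocycle_smul]
    · rw [hr, hr']
      funext w
      rw [rightHom_inr]
      change z (ρ g⁻¹ ((β (g • x)).symm w)) = z ((β x).symm (ρ' (cocycle H K g x)⁻¹ w))
      congr 1
      -- Equivariance at the position whose `β x`-image is `c(g, x)⁻¹ w` says exactly that both
      -- reindexings read the same coordinate.
      have := hβ.equivariant g x ((β x).symm (ρ' (cocycle H K g x)⁻¹ w))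
      rw [Equiv.apply_symm_apply, map_inv, ← Equiv.Perm.mul_apply (ρ' _),
        mul_inv_cancel, Equiv.Perm.one_apply] at this
      rw [map_inv, Equiv.Perm.inv_eq_iff_eq, Equiv.symm_apply_eq, map_inv, this]

variable [StandardBorelSpace X] [StandardBorelSpace Y] [Countable W] [IsProbabilityMeasure ν']

/-- Halo products over matched pairs are coupled when their lamp groups are. -/
theorem exists_isTame_coupling_of_halo (hφ : Monotone φ) (hψ : Monotone ψ)
    (s : IsTameStrictCoupling M N φ ψ fin ℓH ℓK μ)
    (hβ : EquivariantFamily ρ ρ' o o' β) (aℓ : IsAdmissibleGauge b ℓ)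
    (aℓ' : IsAdmissibleGauge b ℓ') (hℓ : ∃ C, ∀ k, ℓ (inr k) ≤ C * (ℓH k + 1))
    (hℓ' : ∃ C, ∀ k, ℓ' (inr k) ≤ C * (ℓK k + 1))
    (τ : A ⋊[r] H →* Equiv.Perm (W → Y))
    (τ' : B ⋊[r'] K →* Equiv.Perm (W' → Y)) (hτ : ∀ g, MeasurePreserving (τ g) ν ν)
    (hτ' : ∀ g, MeasurePreserving (τ' g) ν' ν')
    (hν : ∀ x, MeasurePreserving (fun z : W → Y => fun w => z ((β x).symm w)) ν ν')
    (hf : ∀ᵐ z ∂ν, ∀ a, τ (inl a) z = z → a = 1)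
    (hf' : ∀ᵐ z ∂ν', ∀ a, τ' (inl a) z = z → a = 1)
    (hr : ∀ h z, τ (inr h) z = fun w => z (ρ h⁻¹ w))
    (hr' : ∀ k z, τ' (inr k) z = fun w => z (ρ' k⁻¹ w))
    {T : Set A} {T' : Set B} (hT : Subgroup.closure T = ⊤) (hT' : Subgroup.closure T' = ⊤)
    (h : ∀ a ∈ T, ∃ F : X × (W → Y) → B,
      TameFn φ fin ℓ' (μ.prod ν) (fun p => (inl (F p) : B ⋊[r'] K)) ∧ ∀ x z,
      (fun w => τ (inl a) z ((β x).symm w)) = τ' (inl (F (x, z))) fun w => z ((β x).symm w))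
    (h' : ∀ a ∈ T', ∃ F : X × (W' → Y) → A,
      TameFn ψ fin ℓ (μ.prod ν') (fun p => (inl (F p) : A ⋊[r] H)) ∧ ∀ x z,
      (fun w => τ' (inl a) z (β x w)) = τ (inl (F (x, z))) fun w => z (β x w)) :
    ∃ c : OECoupling (A ⋊[r] H) (B ⋊[r'] K), c.IsTame b φ ψ fin := by
  refine exists_isTame_coupling_of_skew hφ hψ s hβ aℓ aℓ' rightHom rightHom τ τ' hτ hτ' hν
    -- The generating sets may be infinite, and all of the base group is used: the scaling constants
    -- are allowed to depend on the element.
    ?_ ?_ (closure_inl_union_inr hT (Subgroup.closure_univ))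
    (closure_inl_union_inr hT' (Subgroup.closure_univ))
    (exists_tameFn_generators hφ s hβ hℓ' τ τ' hr hr' h)
    (exists_tameFn_generators hψ s.symm (hβ.symm s.toIsStrictCoupling) hℓ τ' τ hr' hr h')
  · filter_upwards [hf] with z hz g hg hg'
    have e : g = inl g.left := by ext <;> simp [show g.right = 1 from hg]
    rw [e] at hg' ⊢
    rw [hz _ hg', map_one]
  · filter_upwards [hf'] with z hz g hg hg'
    have e : g = inl g.left := by ext <;> simp [show g.right = 1 from hg]
    rw [e] at hg' ⊢
    rw [hz _ hg', map_one]

end halo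

/-! ### The family of bijections between the quotients -/

section quotient

variable {H K X : Type*} [Group H] [Group K] [MulAction H X] [MulAction K X]
  [MeasurableSpace X] {μ : Measure X} {M : Subgroup H} {N : Subgroup K} {φ ψ : ℝ≥0 → ℝ≥0}
  {fin : Prop} {ℓH : H → ℕ} {ℓK : K → ℕ}

/-- The map `H ⧸ M → K ⧸ N` induced by the cocycle at `x`: `h M ↦ c(h⁻¹, x)⁻¹ N`. -/
def IsTameStrictCoupling.quotientMap (s : IsTameStrictCoupling M N φ ψ fin ℓH ℓK μ) (x : X) :
    H ⧸ M → K ⧸ N :=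
  Quotient.lift (fun h : H => (((cocycle H K h⁻¹ x)⁻¹ : K) : K ⧸ N)) (by
    intro h h' e
    have hm : h⁻¹ * h' ∈ M := QuotientGroup.leftRel_apply.1 e
    rw [QuotientGroup.eq, inv_inv]
    -- The points `h⁻¹ x` and `h'⁻¹ x` lie in one `M`-orbit, hence in one `N`-orbit. So the two
    -- cocycle values differ by a left factor in `N`, and their inverses lie in the same left coset.
    obtain ⟨n, hn, e'⟩ := s.exists_mem_right (h⁻¹ * h')⁻¹ (h⁻¹ • x) (inv_mem hm)
    have := s.cocycle_mul (h⁻¹ * h')⁻¹ h⁻¹ x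
    rw [s.cocycle_eq e', mul_inv_rev, inv_inv, mul_assoc, mul_inv_cancel, mul_one] at this
    rw [this, mul_inv_rev, mul_inv_cancel_left]
    exact inv_mem hn)

theorem IsTameStrictCoupling.quotientMap_mk (s : IsTameStrictCoupling M N φ ψ fin ℓH ℓK μ) (x : X)
    (h : H) : s.quotientMap x (h : H ⧸ M) = (((cocycle H K h⁻¹ x)⁻¹ : K) : K ⧸ N) := rfl

theorem IsTameStrictCoupling.quotientMap_symm (s : IsTameStrictCoupling M N φ ψ fin ℓH ℓK μ)
    (x : X) (q : H ⧸ M) : s.symm.quotientMap x (s.quotientMap x q) = q := by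
  induction q using QuotientGroup.induction_on with
  | H h =>
    rw [quotientMap_mk, quotientMap_mk, inv_inv, s.cocycle_cocycle, inv_inv]

/-- The bijection between the sets of `M`-orbits and of `N`-orbits inside the orbit of `x`. -/
def IsTameStrictCoupling.quotientEquiv (s : IsTameStrictCoupling M N φ ψ fin ℓH ℓK μ) (x : X) :
    H ⧸ M ≃ K ⧸ N where
  toFun := s.quotientMap x
  invFun := s.symm.quotientMap x
  left_inv := s.quotientMap_symm x
  right_inv := s.symm.quotientMap_symm x

/-- Seen from `x`, the coset of `g` stands for the `M`-orbit of `g⁻¹ x`. Seen from `h x`, the same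
orbit is labelled by the coset of `hg`, as `(hg)⁻¹ h x = g⁻¹ x`. On the `K` side the relabelling is
multiplication by `c(h, x)`. -/
theorem IsTameStrictCoupling.equivariantFamily (s : IsTameStrictCoupling M N φ ψ fin ℓH ℓK μ) :
    EquivariantFamily (MulAction.toPermHom H (H ⧸ M)) (MulAction.toPermHom K (K ⧸ N))
      (fun _ : Unit => ((1 : H) : H ⧸ M)) (fun _ => ((1 : K) : K ⧸ N)) s.quotientEquiv where
  equivariant h x w := by
    induction w using QuotientGroup.induction_on with
    | H g =>
      change s.quotientMap (h • x) ((h * g : H) : H ⧸ M) =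
        ((cocycle H K h x * (cocycle H K g⁻¹ x)⁻¹ : K) : K ⧸ N)
      rw [quotientMap_mk]
      have : cocycle H K (h * g)⁻¹ (h • x) * cocycle H K h x = cocycle H K g⁻¹ x := by
        rw [← s.cocycle_mul, mul_inv_rev, inv_mul_cancel_right]
      rw [← this, mul_inv_rev (cocycle H K (h * g)⁻¹ (h • x)), mul_inv_cancel_left]
  base x _ := by
    change s.quotientMap x ((1 : H) : H ⧸ M) = _
    rw [quotientMap_mk, inv_one, s.cocycle_one, inv_one]
  cover w := by
    induction w using QuotientGroup.induction_on with
    | H g => exact ⟨g, (), congrArg _ (mul_one g).symm⟩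
  cover' w := by
    induction w using QuotientGroup.induction_on with
    | H g => exact ⟨g, (), congrArg _ (mul_one g).symm⟩

end quotient

/-! ### Coordinate permutations and conjugated lamps -/

section tools

open SemidirectProduct

/-- Permutation of coordinates of configurations. -/
def permFun {H W : Type*} [Group H] (ρ : H →* Equiv.Perm W) (Y : Type*) :
    H →* Equiv.Perm (W → Y) where
  toFun h :=
    { toFun := fun z w => z (ρ h⁻¹ w)
      invFun := fun z w => z (ρ h w)
      left_inv := fun z => by funext w; simp
      right_inv := fun z => by funext w; simp }
  map_one' := by ext; simp
  map_mul' h h' := by ext; simp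

theorem measurePreserving_of_semidirect {A H Z : Type*} [Group A] [Group H] [MeasurableSpace Z]
    {r : H →* MulAut A} {ν : Measure Z} (τ : A ⋊[r] H →* Equiv.Perm Z)
    (h₁ : ∀ a, MeasurePreserving (τ (inl a)) ν ν) (h₂ : ∀ h, MeasurePreserving (τ (inr h)) ν ν)
    (g : A ⋊[r] H) : MeasurePreserving (τ g) ν ν := by
  rw [← inl_left_mul_inr_right g, map_mul]
  exact (h₁ _).comp (h₂ _)

variable {B K B' : Type*} [Group B] [Group K] {r : K →* MulAut B}
  {Ω : Type*} [MeasurableSpace Ω] {μ : Measure Ω} [IsFiniteMeasure μ] {φ : ℝ≥0 → ℝ≥0} {fin : Prop}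
  {ℓK : K → ℕ} {ℓB : B' → ℕ} {ℓ : B ⋊[r] K → ℕ}

/-- The action of `f x` on a lamp is conjugation in the semidirect product, so it costs at most
twice the length of `f x` on top of the length of the lamp. -/
theorem TameFn.conj_inr (hφ : Monotone φ) (hℓ : IsGauge ℓ)
    (hK : ∃ C, ∀ k, ℓ (inr k) ≤ C * (ℓK k + 1)) {f : Ω → K} (hf : TameFn φ fin ℓK μ f)
    {f' : Ω → B'} (hf' : TameFn φ fin ℓB μ f') (j : B' → B)
    (hj : ∃ C, ∀ b, ℓ (inl (j b)) ≤ C * (ℓB b + 1)) :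
    TameFn φ fin ℓ μ fun x => (inl (r (f x) (j (f' x))) : B ⋊[r] K) := by
  have h1 : TameFn φ fin ℓ μ fun x => (inr (f x) : B ⋊[r] K) := hf.map hφ inr hK
  have h2 : TameFn φ fin ℓ μ fun x => (inl (j (f' x)) : B ⋊[r] K) :=
    hf'.map hφ (fun b => inl (j b)) hj
  have := (h1.mul hφ hℓ h2).mul hφ hℓ (h1.inv hφ hℓ)
  simpa only [inl_aut, map_inv] using this

end tools

/-! ### Wreath products -/

section wreath

open SemidirectProduct

variable (Γ Y : Type*) [Group Γ] [MulAction Γ Y]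

/-- Coordinatewise action of the direct sum on configurations. -/
def directSumPerm (Q : Type*) : directSumGroup Γ Q →* Equiv.Perm (Q → Y) where
  toFun f :=
    { toFun := fun z q => f.1 q • z q
      invFun := fun z q => (f.1 q)⁻¹ • z q
      left_inv := fun z => by funext q; simp
      right_inv := fun z => by funext q; simp }
  map_one' := by ext z q; simp
  map_mul' f g := by ext z q; simp [mul_smul]

/-- The action of a permutational wreath product on configurations. -/
def wreathPerm (H Q : Type*) [Group H] [MulAction H Q] :
    directSumGroup Γ Q ⋊[wreathAction Γ H Q] H →* Equiv.Perm (Q → Y) :=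
  SemidirectProduct.lift (directSumPerm Γ Y Q) (permFun (MulAction.toPermHom H Q) Y) (by
    intro h
    ext f z q
    change f.1 (h⁻¹ • q) • z q = f.1 (h⁻¹ • q) • z (h • h⁻¹ • q)
    rw [smul_inv_smul])

variable {Γ Y}

theorem wreathPerm_inl {H Q : Type*} [Group H] [MulAction H Q] (f : directSumGroup Γ Q)
    (z : Q → Y) : wreathPerm Γ Y H Q (inl f) z = fun q => f.1 q • z q := by
  rw [wreathPerm, lift_inl]; rfl

theorem wreathPerm_inr {H Q : Type*} [Group H] [MulAction H Q] (h : H)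
    (z : Q → Y) : wreathPerm Γ Y H Q (inr h) z = fun q => z (MulAction.toPermHom H Q h⁻¹ q) := by
  rw [wreathPerm, lift_inr]; rfl

open Classical in
/-- The embedding of `Γ` as the summand of index `q`. -/
def directSumSingle {Q : Type*} (q : Q) : Γ →* directSumGroup Γ Q where
  toFun γ := ⟨Pi.mulSingle q γ, (Set.finite_singleton q).subset fun x hx => by
    by_contra h
    exact hx (Pi.mulSingle_eq_of_ne (M := fun _ => Γ) h γ)⟩
  map_one' := by ext; simp
  map_mul' a b := by ext; simp [Pi.mulSingle_mul]

open Classical in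
theorem directSumSingle_same {Q : Type*} (q : Q) (γ : Γ) : (directSumSingle q γ).1 q = γ :=
  Pi.mulSingle_eq_same (M := fun _ => Γ) q γ

open Classical in
theorem directSumSingle_ne {Q : Type*} {q q' : Q} (h : q' ≠ q) (γ : Γ) :
    (directSumSingle q γ).1 q' = 1 :=
  Pi.mulSingle_eq_of_ne (M := fun _ => Γ) h γ

/-- Induction on a finite set containing the support: one coordinate is split off at a time. -/
theorem closure_directSumSingle (Q : Type*) :
    Subgroup.closure {f : directSumGroup Γ Q | ∃ q γ, f = directSumSingle q γ} = ⊤ := by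
  have key : ∀ s : Set Q, s.Finite → ∀ f : directSumGroup Γ Q, {q | f.1 q ≠ 1} ⊆ s →
      f ∈ Subgroup.closure {f : directSumGroup Γ Q | ∃ q γ, f = directSumSingle q γ} := by
    intro s hs
    induction s, hs using Set.Finite.induction_on with
    | empty =>
      intro f hf
      have : f = 1 := by
        ext q
        by_contra h
        exact hf h
      rw [this]; exact one_mem _
    | @insert a s _ _ ih =>
      intro f hf
      have h := ih ((directSumSingle a (f.1 a))⁻¹ * f) (by
        intro q hq
        by_cases e : q = a
        · subst e
          exact absurd (by simp [directSumSingle_same]) hq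
        · refine (hf ?_).resolve_left e
          intro h
          exact hq (by simp [directSumSingle_ne e, h]))
      have h' := mul_mem (Subgroup.subset_closure ⟨a, f.1 a, rfl⟩ :
        directSumSingle a (f.1 a) ∈ Subgroup.closure
          {f : directSumGroup Γ Q | ∃ q γ, f = directSumSingle q γ}) h
      rwa [mul_inv_cancel_left] at h'
  rw [eq_top_iff]
  intro f _
  exact key _ f.2 f subset_rfl

theorem wreathAction_single {H Q : Type*} [Group H] [MulAction H Q] (h : H) (q : Q) (γ : Γ) :
    wreathAction Γ H Q h (directSumSingle q γ) = directSumSingle (h • q) γ := by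
  ext q'
  change (directSumSingle q γ).1 (h⁻¹ • q') = _
  by_cases e : q' = h • q
  · rw [e, inv_smul_smul, directSumSingle_same, directSumSingle_same]
  · rw [directSumSingle_ne e, directSumSingle_ne fun h' => e (inv_smul_eq_iff.1 h')]

/-- Generators of `K` together with generators of the lamp at the base coset suffice, since `K` is
transitive on `K ⧸ N` and conjugation moves a lamp from one coset to another. -/
theorem exists_gauge_wreath {K : Type*} [Group K] (N : Subgroup K) {b : Bool} {ℓK : K → ℕ}
    {ℓΓ : Γ → ℕ} (aK : IsAdmissibleGauge b ℓK) (aΓ : IsAdmissibleGauge b ℓΓ) :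
    ∃ ℓ : PermWreath Γ N → ℕ, IsAdmissibleGauge b ℓ ∧ (∃ C, ∀ k, ℓ (inr k) ≤ C * (ℓK k + 1)) ∧
      ∃ C, ∀ γ, ℓ (inl (directSumSingle ((1 : K) : K ⧸ N) γ)) ≤ C * (ℓΓ γ + 1) := by
  cases b
  · exact ⟨fun _ => 0, rfl, ⟨0, by simp⟩, ⟨0, by simp⟩⟩
  · obtain ⟨S, hS, hS', rfl⟩ := aK
    obtain ⟨T, hT, hT', rfl⟩ := aΓ
    let i₁ : K →* PermWreath Γ N := inr
    let i₂ : Γ →* PermWreath Γ N := inl.comp (directSumSingle ((1 : K) : K ⧸ N))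
    refine ⟨wordLength (i₁ '' S ∪ i₂ '' T), ⟨_, (hS.image _).union (hT.image _), ?_, rfl⟩,
      ⟨1, fun k => ?_⟩, ⟨1, fun γ => ?_⟩⟩
    · rw [Subgroup.closure_union, ← MonoidHom.map_closure, ← MonoidHom.map_closure, hS', hT',
        eq_top_iff, ← closure_inl_union_inr (closure_directSumSingle (Γ := Γ) (K ⧸ N))
          Subgroup.closure_univ, Subgroup.closure_le]
      have h1 : ∀ k, i₁ k ∈ Subgroup.map i₁ ⊤ ⊔ Subgroup.map i₂ ⊤ := fun k =>
        Subgroup.mem_sup_left ⟨k, Subgroup.mem_top _, rfl⟩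
      rintro _ (⟨_, ⟨q, γ, rfl⟩, rfl⟩ | ⟨k, -, rfl⟩)
      · induction q using QuotientGroup.induction_on with
        | H k =>
          have e : directSumSingle (k : K ⧸ N) γ =
              wreathAction Γ K (K ⧸ N) k (directSumSingle ((1 : K) : K ⧸ N) γ) := by
            rw [wreathAction_single]
            exact congrArg (fun q => directSumSingle q γ) (congrArg _ (mul_one k).symm)
          rw [e, inl_aut]
          exact mul_mem (mul_mem (h1 k) (Subgroup.mem_sup_right ⟨γ, Subgroup.mem_top _, rfl⟩))
            (h1 k⁻¹)
      · exact h1 k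
    · have := wordLength_map_le i₁ (S' := i₁ '' S ∪ i₂ '' T) hS'
        (fun s hs => .inl ⟨s, hs, rfl⟩) k
      exact (this.trans (Nat.le_succ _)).trans_eq (one_mul _).symm
    · have := wordLength_map_le i₂ (S' := i₁ '' S ∪ i₂ '' T) hT'
        (fun s hs => .inr ⟨s, hs, rfl⟩) γ
      exact (this.trans (Nat.le_succ _)).trans_eq (one_mul _).symm

theorem measurePreserving_reindex_infinitePi {W W' Y : Type*} [MeasurableSpace Y] (ν : Measure Y)
    [IsProbabilityMeasure ν] (e : W ≃ W') :
    MeasurePreserving (fun (z : W → Y) w => z (e.symm w)) (Measure.infinitePi fun _ => ν)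
      (Measure.infinitePi fun _ => ν) := by
  have h : (fun (z : W → Y) w => z (e.symm w)) = MeasurableEquiv.piCongrLeft (fun _ => Y) e := by
    funext z w
    obtain ⟨a, rfl⟩ := e.surjective w
    rw [MeasurableEquiv.coe_piCongrLeft, Equiv.piCongrLeft_apply_apply, Equiv.symm_apply_apply]
  rw [h]
  exact ⟨MeasurableEquiv.measurable _, Measure.infinitePi_map_piCongrLeft (fun _ => ν) e⟩

theorem measurePreserving_wreathPerm [MeasurableSpace Y] {ν : Measure Y} [IsProbabilityMeasure ν]
    (hν : ∀ γ : Γ, MeasurePreserving (fun y : Y => γ • y) ν ν)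
    {H Q : Type*} [Group H] [MulAction H Q] (g : directSumGroup Γ Q ⋊[wreathAction Γ H Q] H) :
    MeasurePreserving (wreathPerm Γ Y H Q g) (Measure.infinitePi fun _ => ν)
      (Measure.infinitePi fun _ => ν) := by
  refine measurePreserving_of_semidirect _ (fun f => ?_) (fun h => ?_) g
  · rw [funext (wreathPerm_inl (H := H) (Y := Y) f)]
    refine ⟨measurable_pi_lambda _ fun q => (hν _).measurable.comp (measurable_pi_apply q), ?_⟩
    rw [Measure.infinitePi_map_pi (μ := fun _ => ν) (f := fun q y => f.1 q • y)
      fun q => (hν _).measurable]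
    simp only [(hν _).map_eq]
  · rw [funext (wreathPerm_inr (Γ := Γ) (Y := Y) h)]
    simp only [map_inv]
    exact measurePreserving_reindex_infinitePi ν (MulAction.toPermHom H Q h)

/-- A lamp `γ` at `q` becomes, at `(x, z)`, the lamp `c(γ, z q)` at `β x q`. The first ingredient is
tame through the coupling of the lamp groups, because evaluation at `q` preserves measure, and the
second through `exists_lift`. -/
theorem exists_lamp_wreath {Λ H K X Y : Type*} [Group Λ] [Group H] [Group K] [MulAction H X]
    [MulAction K X] [MeasurableSpace X] {μ : Measure X} [IsProbabilityMeasure μ]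
    [MeasurableSpace Y] [MulAction Γ Y] [MulAction Λ Y] {ν : Measure Y} [IsProbabilityMeasure ν]
    {M : Subgroup H} {N : Subgroup K} {φ ψ : ℝ≥0 → ℝ≥0} {fin : Prop} {b : Bool} {ℓH : H → ℕ}
    {ℓK : K → ℕ} {ℓΓ : Γ → ℕ} {ℓΛ : Λ → ℕ} {ℓ' : PermWreath Λ N → ℕ} (hφ : Monotone φ)
    (s : IsTameStrictCoupling M N φ ψ fin ℓH ℓK μ)
    (t : IsTameStrictCoupling (⊥ : Subgroup Γ) (⊥ : Subgroup Λ) φ ψ fin ℓΓ ℓΛ ν)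
    (aℓ' : IsAdmissibleGauge b ℓ') (hK : ∃ C, ∀ k, ℓ' (inr k) ≤ C * (ℓK k + 1))
    (hΛ : ∃ C, ∀ γ, ℓ' (inl (directSumSingle ((1 : K) : K ⧸ N) γ)) ≤ C * (ℓΛ γ + 1)) :
    ∀ a ∈ {f : directSumGroup Γ (H ⧸ M) | ∃ q γ, f = directSumSingle q γ},
      ∃ F : X × (H ⧸ M → Y) → directSumGroup Λ (K ⧸ N),
      TameFn φ fin ℓ' (μ.prod (Measure.infinitePi fun _ => ν))
        (fun p => (inl (F p) : PermWreath Λ N)) ∧ ∀ x z,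
      (fun w => wreathPerm Γ Y H (H ⧸ M) (inl a) z ((s.quotientEquiv x).symm w)) =
        wreathPerm Λ Y K (K ⧸ N) (inl (F (x, z))) fun w => z ((s.quotientEquiv x).symm w) := by
  rintro _ ⟨q, γ, rfl⟩
  refine ⟨fun p => directSumSingle (s.quotientEquiv p.1 q) (cocycle Γ Λ γ (p.2 q)), ?_,
    fun x z => ?_⟩
  · obtain ⟨-, f, hf, e⟩ := s.equivariantFamily.exists_lift s q
    have h1 := hf.comp (measurePreserving_fst (μ := μ)
      (ν := Measure.infinitePi fun _ : H ⧸ M => ν))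
    have h2 := ((t.tameLeft γ).comp (measurePreserving_eval_infinitePi (fun _ => ν) q)).comp
      (measurePreserving_snd (μ := μ) (ν := Measure.infinitePi fun _ : H ⧸ M => ν))
    have := TameFn.conj_inr hφ aℓ'.isGauge hK h1 h2
      (fun l => directSumSingle ((1 : K) : K ⧸ N) l) hΛ
    simp only [wreathAction_single] at this
    simp only [e]
    exact this
  · rw [wreathPerm_inl, wreathPerm_inl]
    funext w
    dsimp only
    by_cases e : w = s.quotientEquiv x q
    · rw [e, Equiv.symm_apply_apply, directSumSingle_same, directSumSingle_same, t.cocycle_smul]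
    · have e' : (s.quotientEquiv x).symm w ≠ q := fun h => e ((Equiv.symm_apply_eq _).1 h)
      rw [directSumSingle_ne e, directSumSingle_ne e', one_smul, one_smul]

theorem exists_isTame_coupling_wreath {Γ Λ H K : Type*} [Group Γ] [Group Λ] [Group H] [Group K]
    [Countable Γ] [Countable Λ] [Countable H] [Countable K] {M : Subgroup H} {N : Subgroup K}
    {φ ψ : ℝ≥0 → ℝ≥0} {fin : Prop} {b : Bool} (hφ : Monotone φ) (hψ : Monotone ψ)
    (h : ∃ c : OECoupling H K, c.IsPairCoupling M N ∧ c.IsTame b φ ψ fin)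
    (h' : ∃ c : OECoupling Γ Λ, c.IsTame b φ ψ fin) :
    ∃ c : OECoupling (PermWreath Γ M) (PermWreath Λ N), c.IsTame b φ ψ fin := by
  obtain ⟨c₀, hc, hc'⟩ := h
  obtain ⟨c, ℓH, ℓK, aH, aK, s⟩ := hc'.exists_strict M N hc.orbit_eq
  obtain ⟨d₀, hd⟩ := h'
  obtain ⟨d, ℓΓ, ℓΛ, aΓ, aΛ, t⟩ := hd.exists_strict ⊥ ⊥ (.of_forall fun x => by
    ext y; simp [MulAction.mem_orbit_iff])
  obtain ⟨ℓ, aℓ, h1, h2⟩ := exists_gauge_wreath M aH aΓ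
  obtain ⟨ℓ', aℓ', h1', h2'⟩ := exists_gauge_wreath N aK aΛ
  have : Countable (H ⧸ M) := QuotientGroup.mk_surjective.countable
  refine exists_isTame_coupling_of_halo (ν := Measure.infinitePi fun _ => d.μ)
    (ν' := Measure.infinitePi fun _ => d.μ) hφ hψ s s.equivariantFamily aℓ aℓ' h1 h1'
    (wreathPerm Γ d.X H (H ⧸ M)) (wreathPerm Λ d.X K (K ⧸ N))
    (measurePreserving_wreathPerm t.mpLeft) (measurePreserving_wreathPerm t.mpRight)
    (fun x => measurePreserving_reindex_infinitePi _ _) (.of_forall fun z f hf => ?_)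
    (.of_forall fun z f hf => ?_) wreathPerm_inr wreathPerm_inr (closure_directSumSingle _)
    (closure_directSumSingle _) (exists_lamp_wreath hφ s t aℓ' h1' h2')
    (exists_lamp_wreath hψ s.symm t.symm aℓ h1 h2)
  · rw [wreathPerm_inl] at hf
    ext q
    exact t.freeLeft (z q) _ (congrFun hf q)
  · rw [wreathPerm_inl] at hf
    ext q
    exact t.freeRight (z q) _ (congrFun hf q)

end wreath

/-! ### Linear actions on configurations -/

section linear

variable (F : Type*) [Field F]

/-- The isomorphism of vector spaces given by a bijection of their bases. -/
abbrev basisCongr {W W' : Type*} (β : W ≃ W') : (W →₀ F) ≃ₗ[F] (W' →₀ F) :=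
  Finsupp.domLCongr β

/-- Permutations act on the vector space with basis `W`. -/
def permGL (W : Type*) : Equiv.Perm W →* ((W →₀ F) ≃ₗ[F] (W →₀ F)) :=
  permLinear F (Equiv.Perm W) W

theorem permGL_single {W : Type*} (σ : Equiv.Perm W) (w : W) (t : F) :
    permGL F W σ (Finsupp.single w t) = Finsupp.single (σ w) t := by
  change Finsupp.domLCongr (MulAction.toPerm σ) (Finsupp.single w t) = _
  rw [Finsupp.domLCongr_single]; rfl

/-- Precomposing the linear extension of `z` with `g` is again a linear extension. This is what
turns precomposition into an action on configurations. -/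
theorem linearCombination_comp_single {W Y : Type*} [AddCommGroup Y] [Module F Y] (z : W → Y)
    (g : (W →₀ F) →ₗ[F] (W →₀ F)) (v : W →₀ F) :
    Finsupp.linearCombination F
      (fun w => Finsupp.linearCombination F z (g (Finsupp.single w 1))) v =
      Finsupp.linearCombination F z (g v) := by
  have : Finsupp.linearCombination F
      (fun w => Finsupp.linearCombination F z (g (Finsupp.single w 1))) =
      Finsupp.linearCombination F z ∘ₗ g := by
    refine Finsupp.lhom_ext' fun w => LinearMap.ext_ring ?_
    simp
  rw [this, LinearMap.comp_apply]

/-- The action of linear automorphisms on configurations `W → ℕ → F`, seen as linear maps from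
the vector space with basis `W` to `ℕ → F`. -/
def linPerm (W : Type*) : ((W →₀ F) ≃ₗ[F] (W →₀ F)) →* Equiv.Perm (W → ℕ → F) where
  toFun g :=
    { toFun := fun z w => Finsupp.linearCombination F z (g⁻¹ (Finsupp.single w 1))
      invFun := fun z w => Finsupp.linearCombination F z (g (Finsupp.single w 1))
      left_inv := fun z => by
        funext w
        refine (linearCombination_comp_single F z (g⁻¹).toLinearMap _).trans ?_
        change Finsupp.linearCombination F z (g.symm (g _)) = z w
        simp
      right_inv := fun z => by
        funext w
        refine (linearCombination_comp_single F z g.toLinearMap _).trans ?_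
        change Finsupp.linearCombination F z (g (g.symm _)) = z w
        simp }
  map_one' := by ext z w; simp
  map_mul' f g := by
    refine Equiv.ext fun z => funext fun w => ?_
    refine Eq.trans ?_ (linearCombination_comp_single F z (g⁻¹).toLinearMap _).symm
    change Finsupp.linearCombination F z ((f * g)⁻¹ _) = _
    rw [mul_inv_rev]
    rfl

variable {F}

theorem linPerm_apply {W : Type*} (g : (W →₀ F) ≃ₗ[F] (W →₀ F)) (z : W → ℕ → F) (w : W) :
    linPerm F W g z w = Finsupp.linearCombination F z (g⁻¹ (Finsupp.single w 1)) := rfl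

theorem linPerm_permGL {W : Type*} (σ : Equiv.Perm W) (z : W → ℕ → F) :
    linPerm F W (permGL F W σ) z = fun w => z (σ⁻¹ w) := by
  funext w
  rw [linPerm_apply, ← map_inv, permGL_single, Finsupp.linearCombination_single, one_smul]

/-- Reindexing intertwines the actions of automorphisms conjugate under `β`. -/
theorem linPerm_reindex {W W' : Type*} (β : W ≃ W') (g : (W →₀ F) ≃ₗ[F] (W →₀ F))
    (g' : (W' →₀ F) ≃ₗ[F] (W' →₀ F))
    (h : ∀ v, g' (basisCongr F β v) = basisCongr F β (g v)) (z : W → ℕ → F) :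
    (fun w => linPerm F W g z (β.symm w)) = linPerm F W' g' fun w => z (β.symm w) := by
  have hlc : ∀ v : W' →₀ F, Finsupp.linearCombination F (fun w => z (β.symm w)) v =
      Finsupp.linearCombination F z (basisCongr F β.symm v) := by
    intro v
    have : Finsupp.linearCombination F (fun w => z (β.symm w)) =
        Finsupp.linearCombination F z ∘ₗ (basisCongr F β.symm).toLinearMap := by
      refine Finsupp.lhom_ext' fun w => LinearMap.ext_ring ?_
      simp
    rw [this]; rfl
  funext w
  rw [linPerm_apply, linPerm_apply, hlc]
  congr 1
  have h1 := h (g⁻¹ (Finsupp.single (β.symm w) 1))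
  have h2 : g (g⁻¹ (Finsupp.single (β.symm w) (1 : F))) = Finsupp.single (β.symm w) 1 :=
    g.apply_symm_apply _
  rw [h2, Finsupp.domLCongr_single, Equiv.apply_symm_apply] at h1
  have h3 : g'⁻¹ (Finsupp.single w 1) =
      basisCongr F β (g⁻¹ (Finsupp.single (β.symm w) 1)) := by
    rw [← h1]; exact g'.symm_apply_apply _
  rw [h3]
  exact ((basisCongr F β).symm_apply_apply _).symm

theorem continuous_linearCombination [TopologicalSpace F] [DiscreteTopology F] {W : Type*} (v : W →₀ F) :
    Continuous fun z : W → ℕ → F => Finsupp.linearCombination F z v := by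
  simp only [Finsupp.linearCombination_apply, Finsupp.sum]
  exact continuous_finsetSum _ fun w _ => (continuous_apply w).const_smul (v w)

variable [TopologicalSpace F] [DiscreteTopology F] [Finite F] [MeasurableSpace F] [BorelSpace F]

variable (F) in
/-- The Haar probability measure on configurations. -/
def configMeasure (W : Type*) [Countable W] : Measure (W → ℕ → F) :=
  Measure.addHaarMeasure ⊤

instance (W : Type*) [Countable W] : (configMeasure F W).IsAddHaarMeasure := by
  unfold configMeasure; infer_instance

instance (W : Type*) [Countable W] : IsProbabilityMeasure (configMeasure F W) :=
  ⟨Measure.addHaarMeasure_self⟩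

/-- The map is a continuous surjective endomorphism of a compact group, and such a map preserves
Haar measure. -/
theorem measurePreserving_linPerm {W : Type*} [Countable W] (g : (W →₀ F) ≃ₗ[F] (W →₀ F)) :
    MeasurePreserving (linPerm F W g) (configMeasure F W) (configMeasure F W) := by
  let f : (W → ℕ → F) →+ (W → ℕ → F) :=
    { toFun := linPerm F W g
      map_zero' := by
        funext w
        rw [linPerm_apply]; simp
      map_add' := fun z z' => by
        funext w
        simp only [linPerm_apply, Pi.add_apply, Finsupp.linearCombination_apply, Finsupp.sum,
          smul_add, Finset.sum_add_distrib] }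
  exact AddMonoidHom.measurePreserving (f := f)
    (continuous_pi fun w => continuous_linearCombination _) (linPerm F W g).surjective rfl

theorem measurePreserving_reindex_config {W W' : Type*} [Countable W] [Countable W'] (e : W ≃ W') :
    MeasurePreserving (fun (z : W → ℕ → F) w => z (e.symm w)) (configMeasure F W)
      (configMeasure F W') := by
  let f : (W → ℕ → F) →+ (W' → ℕ → F) :=
    { toFun := fun z w => z (e.symm w)
      map_zero' := rfl
      map_add' := fun z z' => rfl }
  refine AddMonoidHom.measurePreserving (f := f)
    (continuous_pi fun w => continuous_apply _) (fun z => ⟨fun w => z (e w), ?_⟩) ?_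
  · funext w
    exact congrArg z (e.apply_symm_apply w)
  · rw [measure_univ, measure_univ]

/-- For fixed `v ≠ 0`, evaluation at `v` is a continuous surjective homomorphism onto `ℕ → F`, so it
sends Haar measure to Haar measure, for which `{0}` is null. There are only countably many `v`. The
countably many copies of `F` are what makes points null. -/
theorem ae_linearCombination_ne_zero {W : Type*} [Countable W] :
    ∀ᵐ z ∂(configMeasure F W), ∀ v : W →₀ F, v ≠ 0 → Finsupp.linearCombination F z v ≠ 0 := by
  rw [ae_all_iff]
  intro v
  by_cases hv : v = 0
  · exact .of_forall fun z h => absurd hv h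
  obtain ⟨w, hw⟩ := Finsupp.ne_iff.1 hv
  let f : (W → ℕ → F) →+ (ℕ → F) :=
    { toFun := fun z => Finsupp.linearCombination F z v
      map_zero' := by simp
      map_add' := fun z z' => by
        simp only [Pi.add_apply, Finsupp.linearCombination_apply, Finsupp.sum, smul_add,
          Finset.sum_add_distrib] }
  let ν : Measure (ℕ → F) := Measure.addHaarMeasure ⊤
  have hν : ν Set.univ = 1 := Measure.addHaarMeasure_self
  have hf : MeasurePreserving f (configMeasure F W) ν := by
    classical
    refine AddMonoidHom.measurePreserving (f := f) (continuous_linearCombination v)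
      (fun y => ⟨Pi.single w ((v w)⁻¹ • y), ?_⟩) (by rw [measure_univ, hν])
    change Finsupp.linearCombination F _ v = y
    rw [Finsupp.linearCombination_apply, Finsupp.sum, Finset.sum_eq_single w]
    · rw [Pi.single_eq_same, smul_smul, mul_inv_cancel₀ hw, one_smul]
    · intro w' _ h
      rw [Pi.single_eq_of_ne h, smul_zero]
    · intro h
      exact absurd (Finsupp.notMem_support_iff.1 h) hw
  -- If 0 were isolated, the compact group `ℕ → F` would be discrete, hence finite.
  have : (nhdsWithin (0 : ℕ → F) {0}ᶜ).NeBot := by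
    by_contra h
    have ho : IsOpen ({0} : Set (ℕ → F)) :=
      isOpen_singleton_iff_punctured_nhds 0 |>.2 (Filter.not_neBot.1 h)
    have hd := discreteTopology_of_isOpen_singleton_zero ho
    have := finite_of_compact_of_discrete (X := ℕ → F)
    exact not_finite (ℕ → F)
  have h0 : ν {0} = 0 := measure_singleton 0
  have := hf.measure_preimage (measurableSet_singleton (0 : ℕ → F)).nullMeasurableSet
  rw [h0] at this
  rw [ae_iff]
  refine measure_mono_null (fun z hz => ?_) this
  by_contra h
  exact hz fun _ => h

end linear

/-! ### Halo products with linear lamp groups -/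

section linearHalo

open SemidirectProduct

variable {A B H K X W W' I : Type*} [Group A] [Group B] [Group H] [Group K] [MulAction H X]
  [MulAction K X] [MeasurableSpace X] {μ : Measure X} [IsProbabilityMeasure μ]
  {M : Subgroup H} {N : Subgroup K} {φ ψ : ℝ≥0 → ℝ≥0} {fin : Prop} {b : Bool} {ℓH : H → ℕ}
  {ℓK : K → ℕ} {r : H →* MulAut A} {r' : K →* MulAut B} {ℓ : A ⋊[r] H → ℕ} {ℓ' : B ⋊[r'] K → ℕ}
  {ρ : H →* Equiv.Perm W} {ρ' : K →* Equiv.Perm W'} {o : I → W} {o' : I → W'} {β : X → W ≃ W'}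

/-- A lamp group acting linearly on the vector space with basis `W`, compatibly with the
permutation action of `H` on `W`. -/
structure IsLinearLamp (F : Type*) [Field F] (r : H →* MulAut A) (ρ : H →* Equiv.Perm W)
    (ι : A →* ((W →₀ F) ≃ₗ[F] (W →₀ F))) : Prop where
  injective : Function.Injective ι
  conj : ∀ h a, ι (r h a) = permGL F W (ρ h) * ι a * (permGL F W (ρ h))⁻¹

/-- The linear representation of the halo product. -/
def IsLinearLamp.hom {F : Type*} [Field F] {ι : A →* ((W →₀ F) ≃ₗ[F] (W →₀ F))}
    (hι : IsLinearLamp F r ρ ι) : A ⋊[r] H →* ((W →₀ F) ≃ₗ[F] (W →₀ F)) :=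
  SemidirectProduct.lift ι ((permGL F W).comp ρ) fun h => MonoidHom.ext fun a => hι.conj h a

theorem IsLinearLamp.hom_inl {F : Type*} [Field F] {ι : A →* ((W →₀ F) ≃ₗ[F] (W →₀ F))}
    (hι : IsLinearLamp F r ρ ι) (a : A) : hι.hom (inl a) = ι a :=
  lift_inl ..

theorem IsLinearLamp.hom_inr {F : Type*} [Field F] {ι : A →* ((W →₀ F) ≃ₗ[F] (W →₀ F))}
    (hι : IsLinearLamp F r ρ ι) (h : H) : hι.hom (inr h) = permGL F W (ρ h) :=
  lift_inr ..

/-- The lamp corresponding to `a` under `β x` exists and depends tamely on `x`. -/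
def IsTransportable {F : Type*} [Field F] (φ : ℝ≥0 → ℝ≥0) (fin : Prop) (ℓ' : B ⋊[r'] K → ℕ)
    (μ : Measure X) (β : X → W ≃ W') (ι : A →* ((W →₀ F) ≃ₗ[F] (W →₀ F)))
    (ι' : B →* ((W' →₀ F) ≃ₗ[F] (W' →₀ F))) (a : A) : Prop :=
  ∃ f : X → B, TameFn φ fin ℓ' μ (fun x => (inl (f x) : B ⋊[r'] K)) ∧
    ∀ x v, ι' (f x) (basisCongr F (β x) v) = basisCongr F (β x) (ι a v)

variable {F : Type*} [Field F] [Finite F]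

/-- If `a` fixes `z`, the linear extension of `z` kills every vector `(ι a)⁻¹ e_w - e_w`. For almost
every `z` it kills only 0, so `ι a` is the identity. -/
theorem IsLinearLamp.ae_free [TopologicalSpace F] [DiscreteTopology F] [MeasurableSpace F]
    [BorelSpace F] [Countable W] {ι : A →* ((W →₀ F) ≃ₗ[F] (W →₀ F))} (hι : IsLinearLamp F r ρ ι) :
    ∀ᵐ z ∂(configMeasure F W), ∀ a, (linPerm F W).comp hι.hom (inl a) z = z → a = 1 := by
  filter_upwards [ae_linearCombination_ne_zero] with z hz a ha
  rw [MonoidHom.comp_apply, hι.hom_inl] at ha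
  refine hι.injective ?_
  rw [map_one, ← inv_eq_one]
  refine LinearEquiv.toLinearMap_injective (Finsupp.lhom_ext' fun w => LinearMap.ext_ring ?_)
  change (ι a)⁻¹ (Finsupp.single w 1) = Finsupp.single w 1
  by_contra h
  refine hz _ (sub_ne_zero.2 h) ?_
  have := congrFun ha w
  rw [linPerm_apply] at this
  rw [map_sub, this, Finsupp.linearCombination_single, one_smul, sub_self]

/-- For linear lamps the transported lamp depends on `x` only and not on the configuration, so
coupling reduces to transporting generators under `β x` in a tame way. -/
theorem exists_isTame_coupling_of_linear [StandardBorelSpace X] [Countable W] [Countable W']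
    (hφ : Monotone φ) (hψ : Monotone ψ)
    (s : IsTameStrictCoupling M N φ ψ fin ℓH ℓK μ) (hβ : EquivariantFamily ρ ρ' o o' β)
    (aℓ : IsAdmissibleGauge b ℓ) (aℓ' : IsAdmissibleGauge b ℓ')
    (hℓ : ∃ C, ∀ k, ℓ (inr k) ≤ C * (ℓH k + 1)) (hℓ' : ∃ C, ∀ k, ℓ' (inr k) ≤ C * (ℓK k + 1))
    {ι : A →* ((W →₀ F) ≃ₗ[F] (W →₀ F))} (hι : IsLinearLamp F r ρ ι)
    {ι' : B →* ((W' →₀ F) ≃ₗ[F] (W' →₀ F))} (hι' : IsLinearLamp F r' ρ' ι')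
    {T : Set A} {T' : Set B} (hT : Subgroup.closure T = ⊤) (hT' : Subgroup.closure T' = ⊤)
    (h : ∀ a ∈ T, IsTransportable φ fin ℓ' μ β ι ι' a)
    (h' : ∀ a ∈ T', IsTransportable ψ fin ℓ μ (fun x => (β x).symm) ι' ι a) :
    ∃ c : OECoupling (A ⋊[r] H) (B ⋊[r'] K), c.IsTame b φ ψ fin := by
  let _ : TopologicalSpace F := ⊥
  have : DiscreteTopology F := ⟨rfl⟩
  let _ : MeasurableSpace F := borel F
  have : BorelSpace F := ⟨rfl⟩
  refine exists_isTame_coupling_of_halo (ν := configMeasure F W) (ν' := configMeasure F W') hφ hψ s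
    hβ aℓ aℓ' hℓ hℓ' ((linPerm F W).comp hι.hom) ((linPerm F W').comp hι'.hom)
    (fun g => measurePreserving_linPerm _) (fun g => measurePreserving_linPerm _)
    (fun x => measurePreserving_reindex_config _) hι.ae_free hι'.ae_free
    (fun h z => ?_) (fun h z => ?_) hT hT' (fun a ha => ?_) (fun a ha => ?_)
  · rw [MonoidHom.comp_apply, hι.hom_inr, linPerm_permGL, map_inv]
  · rw [MonoidHom.comp_apply, hι'.hom_inr, linPerm_permGL, map_inv]
  · obtain ⟨f, hf, e⟩ := h a ha
    refine ⟨fun p => f p.1, hf.comp measurePreserving_fst, fun x z => ?_⟩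
    rw [MonoidHom.comp_apply, MonoidHom.comp_apply, hι.hom_inl, hι'.hom_inl]
    exact linPerm_reindex (β x) _ _ (e x) z
  · obtain ⟨f, hf, e⟩ := h' a ha
    refine ⟨fun p => f p.1, hf.comp measurePreserving_fst, fun x z => ?_⟩
    rw [MonoidHom.comp_apply, MonoidHom.comp_apply, hι.hom_inl, hι'.hom_inl]
    exact linPerm_reindex (β x).symm _ _ (e x) z

end linearHalo

/-! ### Words of bounded length -/

section words

variable {G : Type*} [Group G]

/-- `g` is represented by a word of length at most `n` in the letters `S ∪ S⁻¹`. -/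
def HasWord (S : Set G) (n : ℕ) (g : G) : Prop :=
  ∃ w : List G, w.length ≤ n ∧ (∀ s ∈ w, s ∈ S ∨ s⁻¹ ∈ S) ∧ w.prod = g

namespace HasWord

variable {S : Set G} {m n : ℕ} {g h : G}

theorem one : HasWord S n (1 : G) := ⟨[], by simp, by simp, rfl⟩

theorem of_mem (hg : g ∈ S) : HasWord S 1 g := ⟨[g], by simp, by simp [hg], by simp⟩

theorem mono (hg : HasWord S m g) (hmn : m ≤ n) : HasWord S n g := by
  obtain ⟨w, h1, h2⟩ := hg
  exact ⟨w, h1.trans hmn, h2⟩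

theorem mul (hg : HasWord S m g) (hh : HasWord S n h) : HasWord S (m + n) (g * h) := by
  obtain ⟨v, hv, hv', rfl⟩ := hg
  obtain ⟨w, hw, hw', rfl⟩ := hh
  exact ⟨v ++ w, by rw [List.length_append]; omega,
    fun s hs => (List.mem_append.1 hs).elim (hv' s) (hw' s), List.prod_append⟩

theorem inv (hg : HasWord S m g) : HasWord S m g⁻¹ := by
  obtain ⟨v, hv, hv', rfl⟩ := hg
  refine ⟨(v.map (·⁻¹)).reverse, by simpa using hv, fun s hs => ?_, (List.prod_inv_reverse v).symm⟩
  simp only [List.mem_reverse, List.mem_map] at hs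
  obtain ⟨t, ht, rfl⟩ := hs
  simpa using (hv' t ht).symm

theorem conj (hg : HasWord S m g) (hh : HasWord S n h) : HasWord S (2 * m + n) (g * h * g⁻¹) :=
  ((hg.mul hh).mul hg.inv).mono (by omega)

theorem mem_closure (hg : HasWord S m g) : g ∈ Subgroup.closure S := by
  obtain ⟨w, _, hw, rfl⟩ := hg
  refine list_prod_mem fun s hs => ?_
  rcases hw s hs with h | h
  · exact Subgroup.subset_closure h
  · exact inv_mem_iff.1 (Subgroup.subset_closure h)

theorem wordLength_le (hg : HasWord S m g) : wordLength S g ≤ m := by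
  obtain ⟨w, hm, hw, rfl⟩ := hg
  exact (wordLength_prod_le hw).trans hm

theorem map {G' : Type*} [Group G'] (f : G →* G') {S' : Set G'} (hS : Subgroup.closure S = ⊤)
    (hf : ∀ s ∈ S, f s ∈ S') (g : G) : HasWord S' (wordLength S g) (f g) := by
  obtain ⟨w, hw, hw', rfl⟩ := exists_word hS g
  refine ⟨w.map f, by rw [List.length_map, hw], fun s hs => ?_, (map_list_prod f w).symm⟩
  obtain ⟨t, ht, rfl⟩ := List.mem_map.1 hs
  rcases hw' t ht with h | h
  · exact .inl (hf _ h)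
  · exact .inr (by simpa using hf _ h)

end HasWord

end words

/-! ### Lampshufflers -/

section shuffle

open SemidirectProduct

variable {W : Type*}

open Classical in
/-- Transpositions, as finitely supported permutations. -/
def finSwap (w w' : W) : finSym W :=
  ⟨Equiv.swap w w', (Set.toFinite {w, w'}).subset fun x hx => by
    by_contra h
    simp only [Set.mem_insert_iff, Set.mem_singleton_iff, not_or] at h
    exact hx (Equiv.swap_apply_of_ne_of_ne h.1 h.2)⟩

open Classical in
theorem conj_finSwap (σ : finSym W) (w w' : W) :
    σ * finSwap w w' * σ⁻¹ = finSwap (σ.1 w) (σ.1 w') :=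
  Subtype.ext (Equiv.swap_apply_apply σ.1 w w').symm

open Classical in
theorem finSwap_self (w : W) : finSwap w w = 1 := Subtype.ext (Equiv.swap_self w)

open Classical in
theorem finSwap_apply_left (w w' : W) : (finSwap w w').1 w = w' := Equiv.swap_apply_left _ _

open Classical in
theorem finSwap_apply_right (w w' : W) : (finSwap w w').1 w' = w := Equiv.swap_apply_right _ _

open Classical in
theorem finSwap_apply_ne {w w' u : W} (h : u ≠ w) (h' : u ≠ w') : (finSwap w w').1 u = u :=
  Equiv.swap_apply_of_ne_of_ne h h'

open Classical in
theorem shuffleAction_finSwap {H : Type*} [Group H] (ρ : H →* Equiv.Perm W) (h : H) (w w' : W) :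
    shuffleAction ρ h (finSwap w w') = finSwap (ρ h w) (ρ h w') :=
  Subtype.ext (Equiv.swap_apply_apply (ρ h) w w').symm

theorem closure_finSwap :
    Subgroup.closure {σ : finSym W | ∃ w w', σ = finSwap w w'} = ⊤ := by
  classical
  have key : ∀ σ ∈ Subgroup.closure {σ : Equiv.Perm W | σ.IsSwap},
      σ ∈ (Subgroup.closure {σ : finSym W | ∃ w w', σ = finSwap w w'}).map (finSym W).subtype := by
    rw [← SetLike.le_def, Subgroup.closure_le]
    rintro _ ⟨w, w', -, rfl⟩
    exact ⟨finSwap w w', Subgroup.subset_closure ⟨w, w', rfl⟩, by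
      simp only [finSwap, Subgroup.subtype_apply]⟩
  rw [eq_top_iff]
  intro σ _
  have : σ.1 ∈ Subgroup.closure {σ : Equiv.Perm W | σ.IsSwap} := by
    rw [mem_closure_isSwap']
    exact σ.2
  obtain ⟨τ, hτ, e⟩ := key _ this
  rwa [← Subtype.ext e]

variable {K I : Type*} [Group K] {ρ : K →* Equiv.Perm W} {o : I → W}

theorem inl_finSwap_smul (k : K) (w w' : W) :
    (inl (finSwap (ρ k w) (ρ k w')) : finSym W ⋊[shuffleAction ρ] K) =
      inr k * inl (finSwap w w') * (inr k)⁻¹ := by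
  rw [← shuffleAction_finSwap, inl_aut, map_inv]

/-- Transpositions between translates of orbit representatives have linearly bounded length. -/
theorem hasWord_finSwap {G : Type*} [Group G] (j : finSym W ⋊[shuffleAction ρ] K →* G)
    {S : Set K} (hS : Subgroup.closure S = ⊤) {S' : Set G} (h₁ : ∀ s ∈ S, j (inr s) ∈ S')
    (h₂ : ∀ s, (s ∈ S ∨ s⁻¹ ∈ S ∨ s = 1) → ∀ i i', j (inl (finSwap (o i) (ρ s (o i')))) ∈ S')
    (k : K) (i i' : I) :
    HasWord S' (4 * wordLength S k + 1) (j (inl (finSwap (o i) (ρ k (o i'))))) := by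
  obtain ⟨w, hw, hw', rfl⟩ := exists_word hS k
  rw [← hw]
  clear hw
  induction w with
  | nil => exact (HasWord.of_mem (h₂ 1 (.inr (.inr rfl)) i i')).mono (by simp)
  | cons s w ih =>
    have ih := ih fun t ht => hw' t (List.mem_cons_of_mem _ ht)
    have hs := hw' s List.mem_cons_self
    have hs' : HasWord S' 1 (j (inr s)) := by
      rcases hs with h | h
      · exact .of_mem (h₁ s h)
      · simpa using (HasWord.of_mem (h₁ _ h)).inv
    have hsw : ∀ i', HasWord S' 1 (j (inl (finSwap (o i) (ρ s (o i'))))) := fun i' =>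
      .of_mem (h₂ s (hs.imp_right .inl) i i')
    rw [List.prod_cons, List.length_cons]
    set v := ρ (s * w.prod) (o i') with hv
    have hv' : v = ρ s (ρ w.prod (o i')) := by rw [hv, map_mul, Equiv.Perm.mul_apply]
    -- These two degenerate positions must be set aside, since the conjugation below needs `v` to be
    -- fixed by the transposition of `o i` and `s o i`.
    by_cases e1 : v = o i
    · rw [e1, finSwap_self, map_one, map_one]
      exact .one
    by_cases e2 : v = ρ s (o i)
    · rw [e2]
      exact (hsw i).mono (by omega)
    -- The middle transposition is the `s`-conjugate of the shorter one given by induction.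
    -- Conjugating by `s` and then by a letter costs 2 + 2, whence the factor 4.
    have e : finSwap (o i) v = finSwap (o i) (ρ s (o i)) * finSwap (ρ s (o i)) v *
        (finSwap (o i) (ρ s (o i)))⁻¹ := by
      rw [conj_finSwap, finSwap_apply_right, finSwap_apply_ne e1 e2]
    rw [e, hv', map_mul, map_mul, map_mul, map_mul, inl_finSwap_smul, map_mul, map_mul, map_inv,
      map_inv, map_inv]
    exact ((hsw i).conj (hs'.conj ih)).mono (by omega)

theorem finSwap_mem_closure {G : Type*} [Group G] (j : finSym W ⋊[shuffleAction ρ] K →* G)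
    (ho : ∀ w, ∃ k i, w = ρ k (o i))
    {S : Set K} (hS : Subgroup.closure S = ⊤) {S' : Set G} (h₁ : ∀ s ∈ S, j (inr s) ∈ S')
    (h₂ : ∀ s, (s ∈ S ∨ s⁻¹ ∈ S ∨ s = 1) → ∀ i i', j (inl (finSwap (o i) (ρ s (o i')))) ∈ S')
    (w w' : W) : ∃ n, HasWord S' n (j (inl (finSwap w w'))) := by
  obtain ⟨k, i, rfl⟩ := ho w
  obtain ⟨k', i', rfl⟩ := ho w'
  have e : ρ k' (o i') = ρ k (ρ (k⁻¹ * k') (o i')) := by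
    rw [← Equiv.Perm.mul_apply, ← map_mul, mul_inv_cancel_left]
  rw [e, inl_finSwap_smul, map_mul, map_mul, map_inv]
  exact ⟨_, (HasWord.map (j.comp inr) hS h₁ k).conj (hasWord_finSwap j hS h₁ h₂ _ i i')⟩

/-- Letters for the shuffler part of a halo product. -/
def shuffleLetters {G : Type*} [Group G] (j : finSym W ⋊[shuffleAction ρ] K →* G) (o : I → W)
    (S : Set K) : Set G :=
  (fun s => j (inr s)) '' S ∪
    (fun p : K × I × I => j (inl (finSwap (o p.2.1) (ρ p.1 (o p.2.2))))) ''
      ((S ∪ S⁻¹ ∪ {1}) ×ˢ Set.univ)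

theorem finite_shuffleLetters [Finite I] {G : Type*} [Group G]
    (j : finSym W ⋊[shuffleAction ρ] K →* G) {S : Set K} (hS : S.Finite) :
    (shuffleLetters j o S).Finite :=
  (hS.image _).union ((((hS.union hS.inv).union (Set.finite_singleton 1)).prod
    (Set.toFinite _)).image _)

theorem inr_mem_shuffleLetters {G : Type*} [Group G] (j : finSym W ⋊[shuffleAction ρ] K →* G)
    {S : Set K} : ∀ s ∈ S, j (inr s) ∈ shuffleLetters j o S :=
  fun s hs => .inl ⟨s, hs, rfl⟩

theorem inl_mem_shuffleLetters {G : Type*} [Group G] (j : finSym W ⋊[shuffleAction ρ] K →* G)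
    {S : Set K} : ∀ s, (s ∈ S ∨ s⁻¹ ∈ S ∨ s = 1) → ∀ i i',
      j (inl (finSwap (o i) (ρ s (o i')))) ∈ shuffleLetters j o S :=
  fun s hs i i' => .inr ⟨(s, i, i'), ⟨or_assoc.2 hs, trivial⟩, rfl⟩

/-- The finite generating set consists of generators of `K` and the transpositions joining base
points to their images under these generators, their inverses and 1. Finiteness of `I` keeps the
latter finite in number. -/
theorem exists_gauge_shuffle [Finite I] (ho : ∀ w, ∃ k i, w = ρ k (o i)) {b : Bool} {ℓK : K → ℕ}
    (aK : IsAdmissibleGauge b ℓK) :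
    ∃ ℓ : finSym W ⋊[shuffleAction ρ] K → ℕ, IsAdmissibleGauge b ℓ ∧
      (∃ C, ∀ k, ℓ (inr k) ≤ C * (ℓK k + 1)) ∧
      ∀ i i', ∃ C, ∀ k, ℓ (inl (finSwap (o i) (ρ k (o i')))) ≤ C * (ℓK k + 1) := by
  cases b
  · exact ⟨fun _ => 0, rfl, ⟨0, by simp⟩, fun _ _ => ⟨0, by simp⟩⟩
  · obtain ⟨S, hS, hS', rfl⟩ := aK
    let j := MonoidHom.id (finSym W ⋊[shuffleAction ρ] K)
    have h₁ := inr_mem_shuffleLetters (o := o) j (S := S)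
    have h₂ := inl_mem_shuffleLetters (o := o) j (S := S)
    refine ⟨wordLength (shuffleLetters j o S), ⟨_, finite_shuffleLetters j hS, ?_, rfl⟩,
      ⟨1, fun k => ?_⟩, fun i i' => ⟨4, fun k => ?_⟩⟩
    · rw [eq_top_iff, ← closure_inl_union_inr closure_finSwap Subgroup.closure_univ,
        Subgroup.closure_le]
      rintro _ (⟨_, ⟨w, w', rfl⟩, rfl⟩ | ⟨k, -, rfl⟩)
      · obtain ⟨n, hn⟩ := finSwap_mem_closure j ho hS' h₁ h₂ w w'
        exact hn.mem_closure
      · exact (HasWord.map (j.comp inr) hS' h₁ k).mem_closure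
    · have := (HasWord.map (j.comp inr) hS' h₁ k).wordLength_le
      exact (this.trans (Nat.le_succ _)).trans_eq (one_mul _).symm
    · exact (hasWord_finSwap j hS' h₁ h₂ k i i').wordLength_le.trans (by omega)

theorem permGL_injective (F : Type*) [Field F] : Function.Injective (permGL F W) := by
  intro σ τ h
  ext w
  have := congrArg (fun g : (W →₀ F) ≃ₗ[F] (W →₀ F) => g (Finsupp.single w 1)) h
  simp only [permGL_single] at this
  exact Finsupp.single_left_injective one_ne_zero this

theorem isLinearLamp_shuffle (F : Type*) [Field F] (ρ : K →* Equiv.Perm W) :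
    IsLinearLamp F (shuffleAction ρ) ρ ((permGL F W).comp (finSym W).subtype) where
  injective := (permGL_injective F).comp Subtype.val_injective
  conj k σ := by
    rw [← map_inv, MonoidHom.comp_apply, MonoidHom.comp_apply, ← map_mul, ← map_mul]
    rfl

theorem permGL_basisCongr {F W' : Type*} [Field F] (β : W ≃ W') (w w' : W) (v : W →₀ F) :
    permGL F W' (finSwap (β w) (β w')).1 (basisCongr F β v) =
      basisCongr F β (permGL F W (finSwap w w').1 v) := by
  classical
  have : (permGL F W' (finSwap (β w) (β w')).1).toLinearMap ∘ₗ (basisCongr F β).toLinearMap =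
      (basisCongr F β).toLinearMap ∘ₗ (permGL F W (finSwap w w').1).toLinearMap := by
    refine Finsupp.lhom_ext' fun u => LinearMap.ext_ring ?_
    have h := β.injective.swap_apply w w' u
    simp only [LinearMap.comp_apply, LinearEquiv.coe_coe, Finsupp.lsingle_apply,
      Finsupp.domLCongr_single, permGL_single]
    congr 1
  exact LinearMap.congr_fun this v

variable {H X W' : Type*} [Group H] [MulAction H X]
  [MulAction K X] [MeasurableSpace X] {μ : Measure X} [IsProbabilityMeasure μ]
  {M : Subgroup H} {N : Subgroup K} {φ ψ : ℝ≥0 → ℝ≥0} {fin : Prop} {b : Bool} {ℓH : H → ℕ}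
  {ℓK : K → ℕ} {ρ' : H →* Equiv.Perm W'} {o' : I → W'} {β : X → W' ≃ W}

/-- With lifts `f`, `f'` of the two positions, the transported transposition is the `f x`-conjugate
of the one exchanging `o i` and `(f x)⁻¹ f' x o i'`, whose length is linear in that of `(f x)⁻¹ f'
x`. -/
theorem isTransportable_finSwap (F : Type*) [Field F] (hφ : Monotone φ)
    (s : IsTameStrictCoupling M N φ ψ fin ℓH ℓK μ)
    (hβ : EquivariantFamily ρ' ρ o' o β) (aK : IsGauge ℓK)
    {ℓ : finSym W ⋊[shuffleAction ρ] K → ℕ} (aℓ : IsAdmissibleGauge b ℓ)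
    (h1 : ∃ C, ∀ k, ℓ (inr k) ≤ C * (ℓK k + 1))
    (h2 : ∀ i i', ∃ C, ∀ k, ℓ (inl (finSwap (o i) (ρ k (o i')))) ≤ C * (ℓK k + 1)) :
    ∀ a ∈ {σ : finSym W' | ∃ w w', σ = finSwap w w'},
      IsTransportable φ fin ℓ μ β ((permGL F W').comp (finSym W').subtype)
        ((permGL F W).comp (finSym W).subtype) a := by
  rintro _ ⟨w, w', rfl⟩
  refine ⟨fun x => finSwap (β x w) (β x w'), ?_, fun x v => permGL_basisCongr (β x) w w' v⟩
  obtain ⟨i, f, hf, e⟩ := hβ.exists_lift s w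
  obtain ⟨i', f', hf', e'⟩ := hβ.exists_lift s w'
  have := TameFn.conj_inr hφ aℓ.isGauge h1 hf ((hf.inv hφ aK).mul hφ aK hf')
    (fun k => finSwap (o i) (ρ k (o i'))) (h2 i i')
  simp only [shuffleAction_finSwap, ← Equiv.Perm.mul_apply, ← map_mul, mul_inv_cancel_left] at this
  simpa only [e, e'] using this

theorem exists_isTame_coupling_shuffle [Finite I] [StandardBorelSpace X] [Countable W]
    [Countable W'] (hφ : Monotone φ) (hψ : Monotone ψ)
    (s : IsTameStrictCoupling M N φ ψ fin ℓH ℓK μ)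
    (hβ : EquivariantFamily ρ' ρ o' o β) (aH : IsAdmissibleGauge b ℓH)
    (aK : IsAdmissibleGauge b ℓK) :
    ∃ c : OECoupling (finSym W' ⋊[shuffleAction ρ'] H) (finSym W ⋊[shuffleAction ρ] K),
      c.IsTame b φ ψ fin := by
  obtain ⟨ℓ, aℓ, h1, h2⟩ := exists_gauge_shuffle hβ.cover aH
  obtain ⟨ℓ', aℓ', h1', h2'⟩ := exists_gauge_shuffle hβ.cover' aK
  exact exists_isTame_coupling_of_linear hφ hψ s hβ aℓ aℓ' h1 h1'
    -- Any finite field would do: permutation matrices represent permutations faithfully over each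
    -- of them.
    (isLinearLamp_shuffle (ZMod 2) ρ') (isLinearLamp_shuffle (ZMod 2) ρ) closure_finSwap
    closure_finSwap (isTransportable_finSwap _ hφ s hβ aK.isGauge aℓ' h1' h2')
    (isTransportable_finSwap _ hψ s.symm (hβ.symm s.toIsStrictCoupling) aH.isGauge aℓ h1 h2)

end shuffle

/-! ### Elementary automorphisms -/

section elementary

variable {F W : Type*} [Field F]

/-- The automorphism replacing the basis vector `e_w` by `v`. -/
def replaceBasis (w : W) (v : W →₀ F) (hv : v w ≠ 0) : (W →₀ F) ≃ₗ[F] (W →₀ F) :=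
  LinearEquiv.ofLinearMap
    (LinearMap.id + (Finsupp.lapply w).smulRight (v - Finsupp.single w 1))
    -- The first map multiplies the `w`-coordinate by `v w`, so the inverse subtracts the multiple
    -- of `v - e_w` rescaled by `(v w)⁻¹`.
    (LinearMap.id + (Finsupp.lapply w).smulRight (-(v w)⁻¹ • (v - Finsupp.single w 1)))
    (by
      refine LinearMap.ext fun x => Finsupp.ext fun u => ?_
      simp
      field_simp
      ring)
    (by
      refine LinearMap.ext fun x => Finsupp.ext fun u => ?_
      simp
      field_simp
      ring)

theorem replaceBasis_self (w : W) (v : W →₀ F) (hv : v w ≠ 0) :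
    replaceBasis w v hv (Finsupp.single w 1) = v := by
  simp [replaceBasis]

theorem replaceBasis_ne {w u : W} (v : W →₀ F) (hv : v w ≠ 0) (h : u ≠ w) :
    replaceBasis w v hv (Finsupp.single u 1) = Finsupp.single u 1 := by
  simp [replaceBasis, Finsupp.single_eq_of_ne h.symm]

open Classical in
/-- The automorphism `e_w ↦ a e_w + b e_w'` (the identity if this is not invertible). -/
def elemGL (w w' : W) (a b : F) : finGL F W :=
  -- This coefficient is `a` for `w ≠ w'` and `a + b` for `w = w'`. Testing it in this form covers
  -- dilations and transvections at once and commutes with every bijection of bases.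
  if h : (Finsupp.single w a + Finsupp.single w' b) w ≠ 0 then
    ⟨replaceBasis w _ h, (Set.finite_singleton w).subset fun u hu => by
      by_contra hne
      exact hu (replaceBasis_ne _ h hne)⟩
  else 1

theorem elemGL_ne {w w' u : W} (a b : F) (h : u ≠ w) :
    (elemGL w w' a b).1 (Finsupp.single u 1) = Finsupp.single u 1 := by
  rw [elemGL]
  split_ifs with hv
  · exact replaceBasis_ne _ hv h
  · rfl

theorem elemGL_self {w w' : W} {a b : F} (h : (Finsupp.single w a + Finsupp.single w' b) w ≠ 0) :
    (elemGL w w' a b).1 (Finsupp.single w 1) = Finsupp.single w a + Finsupp.single w' b := by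
  rw [elemGL, dif_pos h]
  exact replaceBasis_self _ _ h

theorem elemGL_eq_one {w w' : W} {a b : F}
    (h : (Finsupp.single w a + Finsupp.single w' b) w = 0) : elemGL w w' a b = 1 := by
  rw [elemGL, dif_neg (not_not.2 h)]

/-- Elementary automorphisms are equivariant under bijections of bases. -/
theorem elemGL_basisCongr {W' : Type*} (β : W ≃ W') (w w' : W) (a b : F) (v : W →₀ F) :
    (elemGL (β w) (β w') a b).1 (basisCongr F β v) = basisCongr F β ((elemGL w w' a b).1 v) := by
  have hs : Finsupp.single (β w) a + Finsupp.single (β w') b =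
      basisCongr F β (Finsupp.single w a + Finsupp.single w' b) := by
    rw [map_add, Finsupp.domLCongr_single, Finsupp.domLCongr_single]
  have hs' : (Finsupp.single (β w) a + Finsupp.single (β w') b) (β w) =
      (Finsupp.single w a + Finsupp.single w' b) w := by
    rw [hs]; simp
  by_cases h : (Finsupp.single w a + Finsupp.single w' b) w = 0
  · rw [elemGL_eq_one h, elemGL_eq_one (hs'.trans h)]; rfl
  have : ((elemGL (β w) (β w') a b).1).toLinearMap ∘ₗ (basisCongr F β).toLinearMap =
      (basisCongr F β).toLinearMap ∘ₗ ((elemGL w w' a b).1).toLinearMap := by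
    refine Finsupp.lhom_ext' fun u => LinearMap.ext_ring ?_
    simp only [LinearMap.comp_apply, LinearEquiv.coe_coe, Finsupp.lsingle_apply,
      Finsupp.domLCongr_single]
    by_cases e : u = w
    · subst e
      rw [elemGL_self h, elemGL_self (hs' ▸ h), hs]
    · rw [elemGL_ne _ _ e, elemGL_ne _ _ (β.injective.ne e), Finsupp.domLCongr_single]
  exact LinearMap.congr_fun this v

theorem finGL_ext {g g' : finGL F W}
    (h : ∀ w, g.1 (Finsupp.single w 1) = g'.1 (Finsupp.single w 1)) : g = g' :=
  Subtype.ext (LinearEquiv.toLinearMap_injective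
    (Finsupp.lhom_ext' fun w => LinearMap.ext_ring (h w)))

variable (F W) in
/-- The subgroup generated by elementary automorphisms. -/
def elemSubgroup : Subgroup (finGL F W) :=
  Subgroup.closure {g | ∃ w w' a b, g = elemGL w w' a b}

theorem elemGL_mem (w w' : W) (a b : F) : elemGL w w' a b ∈ elemSubgroup F W :=
  Subgroup.subset_closure ⟨w, w', a, b, rfl⟩

theorem exists_diagonal_mem (d : W → F) (hd : ∀ w, d w ≠ 0) (t : Finset W) :
    ∃ g ∈ elemSubgroup F W, (∀ w ∈ t, g.1 (Finsupp.single w 1) = Finsupp.single w (d w)) ∧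
      ∀ w ∉ t, g.1 (Finsupp.single w 1) = Finsupp.single w 1 := by
  classical
  induction t using Finset.induction_on with
  | empty => exact ⟨1, one_mem _, by simp, fun _ _ => rfl⟩
  | @insert u t hu ih =>
    obtain ⟨g, hg, h1, h2⟩ := ih
    have hne : (Finsupp.single u (d u) + Finsupp.single u (0 : F)) u ≠ 0 := by simpa using hd u
    refine ⟨g * elemGL u u (d u) 0, mul_mem hg (elemGL_mem _ _ _ _), fun w hw => ?_, fun w hw => ?_⟩
    · change g.1 ((elemGL u u (d u) 0).1 _) = _
      by_cases e : w = u
      · subst e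
        rw [elemGL_self hne, Finsupp.single_zero, add_zero, ← mul_one (d w),
          ← Finsupp.smul_single', map_smul, h2 w hu]
      · rw [elemGL_ne _ _ e, h1 w ((Finset.mem_insert.1 hw).resolve_left e)]
    · change g.1 ((elemGL u u (d u) 0).1 _) = _
      rw [Finset.mem_insert, not_or] at hw
      rw [elemGL_ne _ _ hw.1, h2 w hw.2]

/-- `g` acts by the matrix `A` on the basis vectors in `s` and fixes the others. -/
def ActsBy (s : Finset W) (A : Matrix s s F) (g : finGL F W) : Prop :=
  (∀ w ∉ s, g.1 (Finsupp.single w 1) = Finsupp.single w 1) ∧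
    ∀ j : s, g.1 (Finsupp.single (j : W) 1) = ∑ i : s, A i j • Finsupp.single (i : W) 1

-- Gaussian elimination: an invertible matrix is a product of diagonal matrices and transvections,
-- each realised by elementary automorphisms.
open Classical in
theorem exists_actsBy (s : Finset W) (A : Matrix s s F) (hA : A.det ≠ 0) :
    ∃ g ∈ elemSubgroup F W, ActsBy s A g := by
  refine Matrix.diagonal_transvection_induction_of_det_ne_zero
    (fun A => ∃ g ∈ elemSubgroup F W, ActsBy s A g) A hA (fun D hD => ?_) (fun t => ?_)
    fun A B _ _ hA hB => ?_
  · rw [Matrix.det_diagonal, Finset.prod_ne_zero_iff] at hD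
    obtain ⟨g, hg, h1, h2⟩ := exists_diagonal_mem
      (fun w => if h : w ∈ s then D ⟨w, h⟩ else 1) (fun w => by
        split_ifs with h
        · exact hD _ (Finset.mem_univ _)
        · exact one_ne_zero) s
    refine ⟨g, hg, h2, fun j => ?_⟩
    rw [h1 j j.2, dif_pos j.2, Finset.sum_eq_single j]
    · simp
    · intro i _ hi
      rw [Matrix.diagonal_apply_ne _ hi, zero_smul]
    · simp
  · have hne : (t.i : W) ≠ t.j := fun h => t.hij (Subtype.ext h)
    have hv : (Finsupp.single (t.j : W) 1 + Finsupp.single (t.i : W) t.c : W →₀ F) (t.j : W) ≠ 0 := by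
      simp [Finsupp.single_eq_of_ne hne.symm]
    -- Columns are images of basis vectors, so the transvection with entry `c` at `(i, j)` replaces
    -- `e_j` by `e_j + c e_i`.
    refine ⟨elemGL t.j t.i 1 t.c, elemGL_mem _ _ _ _,
      fun w hw => elemGL_ne _ _ fun h => hw (h ▸ t.j.2), fun j => ?_⟩
    have hsum : ∑ i : s, t.toMatrix i j • Finsupp.single (i : W) (1 : F) =
        Finsupp.single (j : W) 1 + if t.j = j then Finsupp.single (t.i : W) t.c else 0 := by
      simp only [Matrix.TransvectionStruct.toMatrix, Matrix.transvection, Matrix.add_apply,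
        add_smul, Finset.sum_add_distrib]
      congr 1
      · rw [Finset.sum_eq_single j]
        · simp
        · intro i _ hi
          rw [Matrix.one_apply_ne hi, zero_smul]
        · simp
      · rw [Finset.sum_eq_single t.i]
        · by_cases e : t.j = j
          · simp [e]
          · simp [Matrix.single, e]
        · intro i _ hi
          simp [Matrix.single, hi.symm]
        · simp
    rw [hsum]
    by_cases e : t.j = j
    · subst e
      rw [elemGL_self hv, if_pos rfl]
    · rw [if_neg e, add_zero, elemGL_ne _ _ fun h => e (Subtype.ext h.symm)]
  · obtain ⟨g, hg, h1, h2⟩ := hA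
    obtain ⟨g', hg', h1', h2'⟩ := hB
    refine ⟨g * g', mul_mem hg hg', fun w hw => ?_, fun j => ?_⟩
    · change g.1 (g'.1 _) = _
      rw [h1' w hw, h1 w hw]
    · change g.1 (g'.1 _) = _
      rw [h2', map_sum]
      simp only [map_smul, h2, Finset.smul_sum, smul_smul]
      rw [Finset.sum_comm]
      refine Finset.sum_congr rfl fun i _ => ?_
      rw [← Finset.sum_smul, Matrix.mul_apply]
      simp only [mul_comm]

/-- An element of `finGL` preserves the span of a finite set of basis vectors, namely those it moves
together with the supports of their images, and fixes the remaining ones. It is therefore given by a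
finite matrix, invertible because `g` is injective, to which `exists_actsBy` applies. -/
theorem closure_elemGL : Subgroup.closure {g : finGL F W | ∃ w w' a b, g = elemGL w w' a b} = ⊤ := by
  classical
  rw [eq_top_iff]
  intro g _
  let m : Finset W := g.2.toFinset
  let s : Finset W := m ∪ m.biUnion fun w => (g.1 (Finsupp.single w 1)).support
  have hm : ∀ w ∉ m, g.1 (Finsupp.single w 1) = Finsupp.single w 1 := by
    intro w hw
    by_contra h
    exact hw (g.2.mem_toFinset.2 h)
  have hsupp : ∀ w ∈ s, (g.1 (Finsupp.single w 1)).support ⊆ s := by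
    intro w hw
    by_cases h : w ∈ m
    · exact (Finset.subset_biUnion_of_mem
        (fun w => (g.1 (Finsupp.single w 1)).support) h).trans Finset.subset_union_right
    · rw [hm w h]
      exact Finsupp.support_single_subset.trans (Finset.singleton_subset_iff.2 hw)
  let A : Matrix s s F := fun i j => g.1 (Finsupp.single (j : W) 1) i
  have hA : ActsBy s A g := by
    refine ⟨fun w hw => hm w fun h => hw (Finset.mem_union_left _ h), fun j => ?_⟩
    have h1 := Finsupp.sum_single (g.1 (Finsupp.single (j : W) 1))
    rw [Finsupp.sum_of_support_subset _ (hsupp j j.2) _ (by simp)] at h1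
    rw [← Finset.sum_coe_sort] at h1
    conv_lhs => rw [← h1]
    exact Finset.sum_congr rfl fun i _ => by simp [A]
  have hdet : A.det ≠ 0 := by
    intro h0
    obtain ⟨v, hv, hv'⟩ := Matrix.exists_mulVec_eq_zero_iff.2 h0
    obtain ⟨j, hj⟩ := Function.ne_iff.1 hv
    have h1 : g.1 (∑ j : s, v j • Finsupp.single (j : W) 1) = 0 := by
      rw [map_sum]
      simp only [map_smul, hA.2, Finset.smul_sum, smul_smul]
      rw [Finset.sum_comm]
      refine Finset.sum_eq_zero fun i _ => ?_
      rw [← Finset.sum_smul]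
      have := congrFun hv' i
      rw [Matrix.mulVec, dotProduct] at this
      simp only [mul_comm (v _), this, Pi.zero_apply, zero_smul]
    have h2 := (LinearEquiv.map_eq_zero_iff _).1 h1
    have h3 := congrArg (fun u : W →₀ F => u j) h2
    simp only [Finsupp.finsetSum_apply, Finsupp.smul_apply, Finsupp.zero_apply] at h3
    rw [Finset.sum_eq_single j] at h3
    · exact hj (by simpa using h3)
    · intro i _ hi
      rw [Finsupp.single_eq_of_ne fun h => hi (Subtype.ext h.symm), smul_zero]
    · simp
  obtain ⟨g', hg', h'⟩ := exists_actsBy s A hdet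
  have : g = g' := finGL_ext fun w => by
    by_cases hw : w ∈ s
    · rw [hA.2 ⟨w, hw⟩, h'.2 ⟨w, hw⟩]
    · rw [hA.1 w hw, h'.1 w hw]
  rw [this]
  exact hg'

end elementary

/-! ### Lampcloners -/

section cloner

open SemidirectProduct

variable {F : Type*} [Field F] {K Q : Type*} [Group K] [MulAction K Q]

theorem isLinearLamp_cloner : IsLinearLamp F (clonerAction F K Q) (MulAction.toPermHom K Q)
    (finGL F Q).subtype where
  injective := Subtype.val_injective
  conj _ _ := rfl

theorem clonerAction_elemGL (k : K) (q q' : Q) (a b : F) :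
    clonerAction F K Q k (elemGL q q' a b) = elemGL (k • q) (k • q') a b := by
  refine Subtype.ext (LinearEquiv.ext fun v => ?_)
  have := elemGL_basisCongr (MulAction.toPerm k) q q' a b ((permLinear F K Q k)⁻¹ v)
  refine Eq.trans this.symm ?_
  congr 1
  exact (permLinear F K Q k).apply_symm_apply v

variable (F K Q) in
/-- Finitely supported permutations as linear automorphisms. -/
def finSymToFinGL : finSym Q →* finGL F Q :=
  ((permGL F Q).comp (finSym Q).subtype).codRestrict (finGL F Q) fun σ =>
    σ.2.subset fun q hq h => hq (by
      rw [MonoidHom.comp_apply, permGL_single]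
      exact congrArg (fun q => Finsupp.single q 1) h)

variable (F K Q) in
/-- The embedding of the lampshuffler in the lampcloner. -/
def shufflerToCloner : finSym Q ⋊[shuffleAction (MulAction.toPermHom K Q)] K →*
    finGL F Q ⋊[clonerAction F K Q] K :=
  SemidirectProduct.map (finSymToFinGL F Q) (MonoidHom.id K) fun k =>
    MonoidHom.ext fun σ => Subtype.ext ((isLinearLamp_shuffle F (MulAction.toPermHom K Q)).conj k σ)

theorem shufflerToCloner_inl (σ : finSym Q) :
    shufflerToCloner F K Q (inl σ) = inl (finSymToFinGL F Q σ) := map_inl _ _ _ _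

theorem shufflerToCloner_inr (k : K) : shufflerToCloner F K Q (inr k) = inr k := map_inr _ _ _ _

theorem conj_elemGL (σ : finSym Q) (q q' : Q) (a b : F) :
    finSymToFinGL F Q σ * elemGL q q' a b * (finSymToFinGL F Q σ)⁻¹ =
      elemGL (σ.1 q) (σ.1 q') a b := by
  refine Subtype.ext (LinearEquiv.ext fun v => ?_)
  have := elemGL_basisCongr σ.1 q q' a b ((permGL F Q σ.1)⁻¹ v)
  refine Eq.trans this.symm ?_
  congr 1
  exact (permGL F Q σ.1).apply_symm_apply v

theorem inl_elemGL_smul (k : K) (q q' : Q) (a b : F) :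
    (inl (elemGL (k • q) (k • q') a b) : finGL F Q ⋊[clonerAction F K Q] K) =
      inr k * inl (elemGL q q' a b) * (inr k)⁻¹ := by
  rw [← clonerAction_elemGL, inl_aut, map_inv]

/-- Elementary automorphisms from the base point to one other position `q₀` are letters. The
transposition of `q₀` and `k o` fixes the base point, so conjugating by it moves the target to `k
o`. Its length is linear in that of `k` by the estimate for shufflers. -/
theorem hasWord_elemGL {o : Unit → Q} (ho : ∀ q, ∃ (k : K) (i : Unit), q = k • o i) {q₀ : Q}
    (hq₀ : ∀ q, q ≠ o () → q₀ ≠ o ()) {S : Set K} (hS : Subgroup.closure S = ⊤)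
    {S' : Set (finGL F Q ⋊[clonerAction F K Q] K)}
    (h₁ : shuffleLetters (shufflerToCloner F K Q) o S ⊆ S')
    (h₂ : ∀ q, (q = o () ∨ q = q₀) → ∀ a b, inl (elemGL (o ()) q a b) ∈ S') :
    ∃ C, ∀ (k : K) (a b : F),
      HasWord S' (C * (wordLength S k + 1)) (inl (elemGL (o ()) (k • o ()) a b)) := by
  have h₃ := fun s hs => h₁ (inr_mem_shuffleLetters (o := o) (shufflerToCloner F K Q) (S := S) s hs)
  have h₄ := fun s hs i i' => h₁ (inl_mem_shuffleLetters (o := o) (shufflerToCloner F K Q)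
    (S := S) s hs i i')
  obtain ⟨k₀, ⟨⟩, rfl⟩ := ho q₀
  -- Conjugating by `k₀` and then by the resulting transposition gives at most `12 |k₀| + 8 |k| +
  -- 3`, which this constant amply covers.
  refine ⟨16 * wordLength S k₀ + 16, fun k a b => ?_⟩
  by_cases e : k • o () = o ()
  · rw [e]
    exact (HasWord.of_mem (h₂ _ (.inl rfl) a b)).mono (by nlinarith)
  have e₀ := hq₀ _ e
  have hsw := hasWord_finSwap (shufflerToCloner F K Q) hS h₃ h₄ (k₀⁻¹ * k) () ()
  have hk₀ := HasWord.map ((shufflerToCloner F K Q).comp inr) hS h₃ k₀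
  have h := hk₀.conj hsw
  rw [MonoidHom.comp_apply, ← map_mul, ← map_inv, ← map_mul, ← inl_finSwap_smul,
    ← Equiv.Perm.mul_apply, ← map_mul, mul_inv_cancel_left, shufflerToCloner_inl] at h
  have h5 := h.conj (HasWord.of_mem (h₂ _ (.inr rfl) a b))
  rw [← map_mul, ← map_inv, ← map_mul, conj_elemGL] at h5
  have e1 : (finSwap (MulAction.toPermHom K Q k₀ (o ())) (MulAction.toPermHom K Q k (o ()))).1
      (o ()) = o () := finSwap_apply_ne (Ne.symm e₀) (Ne.symm e)
  have e2 : (finSwap (MulAction.toPermHom K Q k₀ (o ())) (MulAction.toPermHom K Q k (o ()))).1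
      (k₀ • o ()) = k • o () := finSwap_apply_left _ _
  rw [e1, e2] at h5
  refine h5.mono ?_
  have hl := (isGauge_wordLength hS).mul_le k₀⁻¹ k
  have hl' := (isGauge_wordLength hS).inv_le k₀
  nlinarith

theorem exists_gauge_cloner [Finite F] {o : Unit → Q}
    (ho : ∀ q, ∃ (k : K) (i : Unit), q = MulAction.toPermHom K Q k (o i)) {b : Bool} {ℓK : K → ℕ}
    (aK : IsAdmissibleGauge b ℓK) :
    ∃ ℓ : finGL F Q ⋊[clonerAction F K Q] K → ℕ, IsAdmissibleGauge b ℓ ∧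
      (∃ C, ∀ k, ℓ (inr k) ≤ C * (ℓK k + 1)) ∧
      ∀ a b, ∃ C, ∀ k : K, ℓ (inl (elemGL (o ()) (k • o ()) a b)) ≤ C * (ℓK k + 1) := by
  cases b
  · exact ⟨fun _ => 0, rfl, ⟨0, by simp⟩, fun _ _ => ⟨0, by simp⟩⟩
  · obtain ⟨S, hS, hS', rfl⟩ := aK
    -- Any second point of `Q` serves. If `Q` has only the base point, the condition is empty and
    -- the base point itself is taken.
    obtain ⟨q₀, hq₀⟩ : ∃ q₀, ∀ q, q ≠ o () → q₀ ≠ o () := by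
      by_cases h : ∃ q, q ≠ o ()
      · obtain ⟨q, hq⟩ := h
        exact ⟨q, fun _ _ => hq⟩
      · exact ⟨o (), fun q hq => (h ⟨q, hq⟩).elim⟩
    let j := shufflerToCloner F K Q
    let E : Set (finGL F Q ⋊[clonerAction F K Q] K) :=
      (fun p : Q × F × F => inl (elemGL (o ()) p.1 p.2.1 p.2.2)) '' ({o (), q₀} ×ˢ Set.univ)
    have hE : E.Finite := ((Set.toFinite _).prod (Set.toFinite _)).image _
    obtain ⟨C, hC⟩ := hasWord_elemGL ho hq₀ hS' (S' := shuffleLetters j o S ∪ E)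
      Set.subset_union_left (fun q hq a b => .inr ⟨(q, a, b), ⟨by simpa using hq, trivial⟩, rfl⟩)
    have hinr : ∀ k, HasWord (shuffleLetters j o S ∪ E) (wordLength S k) (inr k) := fun k => by
      rw [← shufflerToCloner_inr (F := F)]
      exact HasWord.map (j.comp inr) hS' (fun s hs => .inl (inr_mem_shuffleLetters j s hs)) k
    refine ⟨wordLength (shuffleLetters j o S ∪ E),
      ⟨_, (finite_shuffleLetters j hS).union hE, ?_, rfl⟩, ⟨1, fun k => ?_⟩,
      fun a b => ⟨C, fun k => (hC k a b).wordLength_le⟩⟩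
    · rw [eq_top_iff, ← closure_inl_union_inr (closure_elemGL (F := F) (W := Q))
        Subgroup.closure_univ, Subgroup.closure_le]
      rintro _ (⟨_, ⟨q, q', a, b, rfl⟩, rfl⟩ | ⟨k, -, rfl⟩)
      · obtain ⟨k, ⟨⟩, rfl⟩ := ho q
        obtain ⟨k', ⟨⟩, rfl⟩ := ho q'
        have e : k' • o () = k • (k⁻¹ * k') • o () := by rw [← mul_smul, mul_inv_cancel_left]
        change inl (elemGL (k • o ()) (k' • o ()) a b) ∈ _
        rw [e, inl_elemGL_smul]
        exact ((hinr k).conj (hC (k⁻¹ * k') a b)).mem_closure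
      · exact (hinr k).mem_closure
    · have := (hinr k).wordLength_le
      exact (this.trans (Nat.le_succ _)).trans_eq (one_mul _).symm

variable {H P X : Type*} [Group H] [MulAction H P] [MulAction H X]
  [MulAction K X] [MeasurableSpace X] {μ : Measure X} [IsProbabilityMeasure μ]
  {M : Subgroup H} {N : Subgroup K} {φ ψ : ℝ≥0 → ℝ≥0} {fin : Prop} {b : Bool} {ℓH : H → ℕ}
  {ℓK : K → ℕ} {o' : Unit → P} {o : Unit → Q} {β : X → P ≃ Q}

/-- As for transpositions, translating by the lift of the first position reduces to an elementary
automorphism based at `o`, whose length is linear in that of the relative displacement. -/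
theorem isTransportable_elemGL (hφ : Monotone φ) (s : IsTameStrictCoupling M N φ ψ fin ℓH ℓK μ)
    (hβ : EquivariantFamily (MulAction.toPermHom H P) (MulAction.toPermHom K Q) o' o β)
    (aK : IsGauge ℓK) {ℓ : finGL F Q ⋊[clonerAction F K Q] K → ℕ} (aℓ : IsAdmissibleGauge b ℓ)
    (h1 : ∃ C, ∀ k, ℓ (inr k) ≤ C * (ℓK k + 1))
    (h2 : ∀ a b, ∃ C, ∀ k : K, ℓ (inl (elemGL (o ()) (k • o ()) a b)) ≤ C * (ℓK k + 1)) :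
    ∀ g ∈ {g : finGL F P | ∃ p p' a b, g = elemGL p p' a b},
      IsTransportable φ fin ℓ μ β (finGL F P).subtype (finGL F Q).subtype g := by
  rintro _ ⟨p, p', a, b, rfl⟩
  refine ⟨fun x => elemGL (β x p) (β x p') a b, ?_,
    fun x v => elemGL_basisCongr (β x) p p' a b v⟩
  obtain ⟨⟨⟩, f, hf, e⟩ := hβ.exists_lift s p
  obtain ⟨⟨⟩, f', hf', e'⟩ := hβ.exists_lift s p'
  have := TameFn.conj_inr hφ aℓ.isGauge h1 hf ((hf.inv hφ aK).mul hφ aK hf')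
    (fun k => elemGL (o ()) (k • o ()) a b) (h2 a b)
  simp only [clonerAction_elemGL, ← mul_smul, mul_inv_cancel_left] at this
  simp only [e, e']
  exact this

theorem exists_isTame_coupling_cloner [Finite F] [StandardBorelSpace X] [Countable P] [Countable Q]
    (hφ : Monotone φ) (hψ : Monotone ψ) (s : IsTameStrictCoupling M N φ ψ fin ℓH ℓK μ)
    (hβ : EquivariantFamily (MulAction.toPermHom H P) (MulAction.toPermHom K Q) o' o β)
    (aH : IsAdmissibleGauge b ℓH) (aK : IsAdmissibleGauge b ℓK) :
    ∃ c : OECoupling (finGL F P ⋊[clonerAction F H P] H) (finGL F Q ⋊[clonerAction F K Q] K),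
      c.IsTame b φ ψ fin := by
  obtain ⟨ℓ, aℓ, h1, h2⟩ := exists_gauge_cloner (F := F) hβ.cover aH
  obtain ⟨ℓ', aℓ', h1', h2'⟩ := exists_gauge_cloner (F := F) hβ.cover' aK
  exact exists_isTame_coupling_of_linear hφ hψ s hβ aℓ aℓ' h1 h1'
    isLinearLamp_cloner isLinearLamp_cloner closure_elemGL closure_elemGL
    (isTransportable_elemGL hφ s hβ aK.isGauge aℓ' h1' h2')
    (isTransportable_elemGL hψ s.symm (hβ.symm s.toIsStrictCoupling) aH.isGauge aℓ h1 h2)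

end cloner

/-! ### All halo products -/

/-- The label in `Fin r` is inert, so there are `r` orbits of positions and one base point for each.
With this family, jugglers become shufflers on a larger set. -/
theorem EquivariantFamily.juggler {H K X : Type*} [Group H] [Group K] [MulAction H X]
    [MulAction K X] {M : Subgroup H} {N : Subgroup K} {o : Unit → H ⧸ M} {o' : Unit → K ⧸ N}
    {β : X → H ⧸ M ≃ K ⧸ N}
    (hβ : EquivariantFamily (MulAction.toPermHom H (H ⧸ M)) (MulAction.toPermHom K (K ⧸ N)) o o' β)
    (r : ℕ) : EquivariantFamily (jugglerPerm M r) (jugglerPerm N r)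
      (fun i : Fin r => (o (), i)) (fun i => (o' (), i))
      fun x => Equiv.prodCongr (β x) (Equiv.refl (Fin r)) where
  equivariant h x w := Prod.ext (hβ.equivariant h x w.1) rfl
  base x i := Prod.ext (hβ.base x ()) rfl
  cover w := by
    obtain ⟨h, ⟨⟩, e⟩ := hβ.cover w.1
    exact ⟨h, w.2, Prod.ext e rfl⟩
  cover' w := by
    obtain ⟨h, ⟨⟩, e⟩ := hβ.cover' w.1
    exact ⟨h, w.2, Prod.ext e rfl⟩

theorem exists_isTame_coupling_halo_products {Γ Λ H K 𝕜 : Type*} [Group Γ] [Group Λ] [Group H]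
    [Group K] [Countable Γ] [Countable Λ] [Countable H] [Countable K] [Field 𝕜] [Finite 𝕜]
    {M : Subgroup H} {N : Subgroup K} {φ ψ : ℝ≥0 → ℝ≥0} {fin : Prop} {b : Bool}
    (hφ : Monotone φ) (hψ : Monotone ψ)
    (h : ∃ c : OECoupling H K, c.IsPairCoupling M N ∧ c.IsTame b φ ψ fin) :
    ((∃ c : OECoupling Γ Λ, c.IsTame b φ ψ fin) →
      ∃ c : OECoupling (PermWreath Γ M) (PermWreath Λ N), c.IsTame b φ ψ fin) ∧
    (∃ c : OECoupling (Lampshuffler M) (Lampshuffler N), c.IsTame b φ ψ fin) ∧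
    (∀ r : ℕ, ∃ c : OECoupling (Lampjuggler r M) (Lampjuggler r N), c.IsTame b φ ψ fin) ∧
    (∃ c : OECoupling (Lampcloner 𝕜 M) (Lampcloner 𝕜 N), c.IsTame b φ ψ fin) := by
  have h₀ := h
  obtain ⟨c₀, hc, hc'⟩ := h₀
  obtain ⟨c, ℓH, ℓK, aH, aK, s⟩ := hc'.exists_strict M N hc.orbit_eq
  have : Countable (H ⧸ M) := QuotientGroup.mk_surjective.countable
  have : Countable (K ⧸ N) := QuotientGroup.mk_surjective.countable
  exact ⟨exists_isTame_coupling_wreath hφ hψ h,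
    exists_isTame_coupling_shuffle hφ hψ s s.equivariantFamily aH aK,
    fun r => exists_isTame_coupling_shuffle hφ hψ s (s.equivariantFamily.juggler r) aH aK,
    exists_isTame_coupling_cloner hφ hψ s s.equivariantFamily aH aK⟩

end

theorem theoremA {Γ Λ H K 𝕜 : Type*} [Group Γ] [Group Λ] [Group H] [Group K]
    [Countable Γ] [Countable Λ] [Countable H] [Countable K] [Field 𝕜] [Finite 𝕜]
    (M : Subgroup H) [M.Normal] (N : Subgroup K) [N.Normal] :
    -- quantitative statement, for finitely generated groups
    (∀ φ ψ : ℝ≥0 → ℝ≥0, Monotone φ → Monotone ψ → Group.FG H → Group.FG K →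
      (∃ c : OECoupling H K, c.IsPairCoupling M N ∧ c.IsIntegrable φ ψ) →
        (Group.FG Γ → Group.FG Λ → (∃ c : OECoupling Γ Λ, c.IsIntegrable φ ψ) →
          ∃ c : OECoupling (PermWreath Γ M) (PermWreath Λ N), c.IsIntegrable φ ψ) ∧
        (∃ c : OECoupling (Lampshuffler M) (Lampshuffler N), c.IsIntegrable φ ψ) ∧
        (∀ r : ℕ, 1 ≤ r →
          ∃ c : OECoupling (Lampjuggler r M) (Lampjuggler r N), c.IsIntegrable φ ψ) ∧
        (∃ c : OECoupling (Lampcloner 𝕜 M) (Lampcloner 𝕜 N), c.IsIntegrable φ ψ)) ∧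
    -- plain orbit equivalence, for countable groups
    ((∃ c : OECoupling H K, c.IsPairCoupling M N) →
        (Nonempty (OECoupling Γ Λ) → Nonempty (OECoupling (PermWreath Γ M) (PermWreath Λ N))) ∧
        Nonempty (OECoupling (Lampshuffler M) (Lampshuffler N)) ∧
        (∀ r : ℕ, 1 ≤ r → Nonempty (OECoupling (Lampjuggler r M) (Lampjuggler r N))) ∧
        Nonempty (OECoupling (Lampcloner 𝕜 M) (Lampcloner 𝕜 N))) ∧
    -- essentially bounded orbit equivalence, for countable groups
    ((∃ c : OECoupling H K, c.IsPairCoupling M N ∧ c.IsLInftyCoupling) →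
        ((∃ c : OECoupling Γ Λ, c.IsLInftyCoupling) →
          ∃ c : OECoupling (PermWreath Γ M) (PermWreath Λ N), c.IsLInftyCoupling) ∧
        (∃ c : OECoupling (Lampshuffler M) (Lampshuffler N), c.IsLInftyCoupling) ∧
        (∀ r : ℕ, 1 ≤ r →
          ∃ c : OECoupling (Lampjuggler r M) (Lampjuggler r N), c.IsLInftyCoupling) ∧
        (∃ c : OECoupling (Lampcloner 𝕜 M) (Lampcloner 𝕜 N), c.IsLInftyCoupling)) := by
  refine ⟨fun φ ψ hφ hψ _ _ h => ?_, fun h => ?_, fun h => ?_⟩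
  · simp only [OECoupling.isIntegrable_iff] at h ⊢
    obtain ⟨h1, h2, h3, h4⟩ :=
      exists_isTame_coupling_halo_products (Γ := Γ) (Λ := Λ) (𝕜 := 𝕜) hφ hψ h
    exact ⟨fun _ _ => h1, h2, fun r _ => h3 r, h4⟩
  -- Zero length and control functions make every bound vacuous, leaving plain orbit equivalence.
  · have h' : ∃ c : OECoupling H K, c.IsPairCoupling M N ∧
        c.IsTame false (fun _ => 0) (fun _ => 0) False := by
      simpa [OECoupling.isTame_false_iff] using h
    obtain ⟨h1, h2, h3, h4⟩ :=
      exists_isTame_coupling_halo_products (Γ := Γ) (Λ := Λ) (𝕜 := 𝕜) monotone_const monotone_const h'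
    simp only [OECoupling.isTame_false_iff, false_imp_iff, exists_const_iff, and_true] at h1 h2 h3 h4
    exact ⟨h1, h2, fun r _ => h3 r, h4⟩
  · have h' : ∃ c : OECoupling H K, c.IsPairCoupling M N ∧
        c.IsTame false (fun _ => 0) (fun _ => 0) True := by
      simpa [OECoupling.isTame_false_iff] using h
    obtain ⟨h1, h2, h3, h4⟩ :=
      exists_isTame_coupling_halo_products (Γ := Γ) (Λ := Λ) (𝕜 := 𝕜) monotone_const monotone_const h'
    simp only [OECoupling.isTame_false_iff, true_imp_iff] at h1 h2 h3 h4
    exact ⟨h1, h2, fun r _ => h3 r, h4⟩
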